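/- A $d$-dimensional vector-valued modular form (vvmf) is a tuple $v=(v_1,\dots,v_d)$ of holomorphic functions on the upper half-plane $\mathbb H$ such that $v(\gamma\tau)=\rho(\gamma)v(\tau)$ for all $\gamma\in SL(2,\mathbb Z)$, for some representation $\rho:SL(2,\mathbb Z)\to GL(d,\mathbb C)$, and such that, with $q=e^{2\pi i\tau}$, each component has an expansion $v_i=q^{m_0^{(i)}}\sum_{n\ge 0}c^{(i)}_n q^{n/b^{(i)}}$ with $m_0^{(i)}\in\mathbb R$, $b^{(i)}\in\mathbb Z_{>0}$, $c_0^{(i)}\neq 0$. If $v_1,\dots,v_d$ are linearly independent, the Wronskian index of $v$ is $$\ell=6\Big(\tfrac12\,\mathrm{ord}_i(W)+\tfrac13\,\mathrm{ord}_{e^{2\pi i/3}}(W)+\sum_{p\in\mathbb H/SL(2,\mathbb Z),\ p\ne i,\,e^{2\pi i/3}}\mathrm{ord}_p(W)\Big),$$ where $W=\det\big((q\,\tfrac{d}{dq})^{a}v_i\big)_{0\le a<d,\,1\le i\le d}$. An antichiral vvmf $\bar v=(\bar v_1,\dots,\bar v_d)$ is the complex conjugate of a vvmf $w$ (which need not be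 related to $v$); its leading exponents $\bar m_0^{(j)}$ (in $\bar q$) and its Wronskian index $\bar\ell$ are those of $w$. Let $v$ and $\bar v$ be a chiral and an antichiral $d$-dimensional vvmf, let $N$ be a complex $d\times d$ matrix, and suppose that $F=\sum_{i,j}N_{ij}\,v_i(q)\,\bar v_j(\bar q)$ is not identically zero and is invariant under $SL(2,\mathbb Z)$. Put $x_0=\min\{m_0^{(i)}+\bar m_0^{(j)} : N_{ij}\ne 0\}$. Then: 1. Suppose that $v_1,\dots,v_d$ are linearly independent and that $\bar v_1,\dots,\bar v_d$ are linearly independent. Then, for every such $N$, $$\min_{1\le i,j\le d}\big(m_0^{(i)}+\bar m_0^{(j)}\big)\le \frac{d-1}{6}-\frac{\ell+\bar\ell}{6d}.$$ If moreover $N$ glues the characters in $d$ pairs, that is, $N_{i\sigma(i)}\neq0$ for all $i$ for some permutation $\sigma$ of $\{1,\dots,d\}$ (for example, if $N$ is nonsingular), then $$x_0\le \frac{d-1}{6}-\frac{\ell+\bar\ell}{6d}.$$ 2. For every such $N$, and without assuming linear independence, $x_0\le \frac{d-1}{6}$. -/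

import Mathlib

open scoped MatrixGroups Manifold ComplexConjugate

noncomputable section

namespace ModularGluing

/-- `f` has a Fourier expansion `f(τ) = q^m ∑_{n ≥ 0} c_n q^{n/b}` on the whole upper half-plane, where
`q^x = exp(2πi x τ)`, `b` is a positive integer and `c_0 ≠ 0`; so `m` is the leading exponent. -/
def HasLeadingExponent (f : UpperHalfPlane → ℂ) (m : ℝ) : Prop :=
  ∃ b : ℕ, 0 < b ∧ ∃ c : ℕ → ℂ, c 0 ≠ 0 ∧ ∀ τ : UpperHalfPlane,
    HasSum (fun n : ℕ => c n *
      Complex.exp (2 * Real.pi * Complex.I * ((m : ℂ) + (n : ℂ) / (b : ℂ)) * (τ : ℂ))) (f τ)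

/-- A `d`-dimensional (weakly holomorphic, weight zero) vector-valued modular form for `SL(2, ℤ)`,
together with its representation and the leading exponents of its components. -/
structure VVMF (d : ℕ) where
  /-- the components `v_i` -/
  comp : Fin d → UpperHalfPlane → ℂ
  /-- the representation by which the components transform -/
  rep : SL(2, ℤ) →* GL (Fin d) ℂ
  /-- the leading exponents of the components -/
  exponent : Fin d → ℝ
  holo : ∀ i, MDifferentiable 𝓘(ℂ) 𝓘(ℂ) (comp i)
  transform : ∀ (γ : SL(2, ℤ)) (τ : UpperHalfPlane) (i : Fin d),
    comp i (γ • τ) = ∑ j, (rep γ : Matrix (Fin d) (Fin d) ℂ) i j * comp j τ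
  expansion : ∀ i, HasLeadingExponent (comp i) (exponent i)

/-- The Wronskian determinant `det (D^a v_i)`, `0 ≤ a < d`, with `D = q d/dq = (2πi)⁻¹ d/dτ`.
(Replacing the powers of `D` by iterated Serre derivatives does not change the determinant.) -/
def wronskian {d : ℕ} (v : Fin d → UpperHalfPlane → ℂ) (τ : UpperHalfPlane) : ℂ :=
  Matrix.det (Matrix.of fun a i : Fin d =>
    (Derivative.normalizedDerivOfComplex^[(a : ℕ)] (v i)) τ)

/-- The order of vanishing at `p` of a function which is holomorphic on the upper half-plane and
not identically zero. -/
def ordAt (f : UpperHalfPlane → ℂ) (p : UpperHalfPlane) : ℕ :=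
  analyticOrderNatAt (f ∘ UpperHalfPlane.ofComplex) (p : ℂ)

/-- The elliptic point `e^{2πi/3}`. -/
def rhoPoint : UpperHalfPlane :=
  ⟨Complex.exp (2 * Real.pi * Complex.I / 3), by
    have h : (2 * Real.pi * Complex.I / 3 : ℂ) = ((2 * Real.pi / 3 : ℝ) : ℂ) * Complex.I := by
      push_cast
      ring
    rw [h, Complex.exp_ofReal_mul_I_im]
    apply Real.sin_pos_of_pos_of_lt_pi <;> linarith [Real.pi_pos]⟩

/-- The orbit of a point in `ℍ / SL(2, ℤ)`. -/
def orbitOf (p : UpperHalfPlane) : MulAction.orbitRel.Quotient SL(2, ℤ) UpperHalfPlane :=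
  Quotient.mk _ p

/-- The number of zeros of `f` in `ℍ / SL(2, ℤ)`, zeros in the orbits of `i` and `e^{2πi/3}` being
counted with the weights `1/2` and `1/3`. It is meant for `f ≠ 0` whose order of vanishing is
constant on orbits, so that the choice of representatives is immaterial. -/
def zeroCount (f : UpperHalfPlane → ℂ) : ℝ :=
  (1 / 2) * (ordAt f UpperHalfPlane.I : ℝ) + (1 / 3) * (ordAt f rhoPoint : ℝ) +
    ∑ᶠ x ∈ ({orbitOf UpperHalfPlane.I, orbitOf rhoPoint}ᶜ :
      Set (MulAction.orbitRel.Quotient SL(2, ℤ) UpperHalfPlane)), (ordAt f x.out : ℝ)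

/-- The Wronskian index `ℓ`: six times the number of zeros of the Wronskian determinant. -/
def VVMF.wronskianIndex {d : ℕ} (v : VVMF d) : ℝ :=
  6 * zeroCount (wronskian v.comp)

/-- The function `F = ∑ N_{ij} v_i(q) w̄_j(q̄)` on the upper half-plane (`τ̄` is the conjugate of `τ`).
An antichiral vector-valued modular form is the complex conjugate of a chiral one, here of `w`: it
has the leading exponents (in `q̄`) and the Wronskian index of `w`. -/
def glue {d : ℕ} (N : Matrix (Fin d) (Fin d) ℂ) (v w : VVMF d) (τ : UpperHalfPlane) : ℂ :=
  ∑ i, ∑ j, N i j * v.comp i τ * conj (w.comp j τ)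

/-- The gluing matrix glues the `d` chiral characters to the `d` antichiral ones in `d` pairs: some
permutation `σ` has `N_{i σ(i)} ≠ 0` for all `i`. -/
def GluesInPairs {d : ℕ} (N : Matrix (Fin d) (Fin d) ℂ) : Prop :=
  ∃ σ : Equiv.Perm (Fin d), ∀ i, N i (σ i) ≠ 0

/-- Every nonsingular gluing matrix glues in pairs. -/
theorem gluesInPairs_of_det_ne_zero {d : ℕ} {N : Matrix (Fin d) (Fin d) ℂ} (h : N.det ≠ 0) :
    GluesInPairs N := by
  rw [← Matrix.det_transpose, Matrix.det_apply] at h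
  obtain ⟨σ, -, hσ⟩ := Finset.exists_ne_zero_of_sum_ne_zero h
  refine ⟨σ, fun i hi => hσ ?_⟩
  rw [Finset.prod_eq_zero (Finset.mem_univ i) (by simpa using hi), smul_zero]

/-- `x₀` is the least `m₀^{(i)} + m̄₀^{(j)}` over the pairs `(i, j)` with `N_{ij} ≠ 0`. -/
def IsGluedExponent {d : ℕ} (N : Matrix (Fin d) (Fin d) ℂ) (v w : VVMF d) (x₀ : ℝ) : Prop :=
  IsLeast {x : ℝ | ∃ i j, N i j ≠ 0 ∧ x = v.exponent i + w.exponent j} x₀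

end ModularGluing

end

/-! The engine is a valence inequality for Wronskians. The Wronskian `W` of `d` independent
components is a nonzero holomorphic form of weight `d(d-1)` with character `det ρ`, and it is
`O(|q|^{∑ m_i})` at the cusp. A form of even weight `k` with a character has cusp order plus
weighted number of zeros at most `k/12` (`exists_order_add_zeroCount_le`), so `∑ m_i ≤ d(d-1)/12 -
ℓ/6`. Adding the antichiral bound and averaging over the pairs `(i, σ i)` of a permutation proves
the first claim: the identity handles the minimum over all pairs, a gluing permutation handles `x₀`.

For the second claim, write `F = ∑ f_k conj(g_k)` with the fewest terms `r ≤ d`, where `f_k` and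
`g_k` lie in the spans of the components. Minimality makes both families independent. By
polarization, `W(f)(z) conj(W(g)(z'))` is a determinant of mixed derivatives of `F`, so it depends
on `F` alone. Invariance of `F` then forces `W(f)` and `W(g)` to have characters, and computing the
same determinant from `N` shows that their product is `O(|q|^{r x₀})`. The valence inequality for
both gives `r x₀ ≤ r(r-1)/6`.

The valence inequality is algebraic: for suitable `n`, `W^12 Δ^n` is a level one form, hence `Δ^K
P(j)`, and its zeros are the roots of `P` because `j` separates orbits. That separation follows from
an open-closed argument on the set of multiply attained values. -/

namespace ModularGluing

open UpperHalfPlane hiding I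
open Complex Filter Asymptotics Topology ModularForm
open Derivative (normalizedDerivOfComplex normalizedDerivOfComplex_mdifferentiable
  normalizedDerivOfComplex_mul normalizedDerivOfComplex_pow serreDerivative)

local notation "𝒟₁" => normalizedDerivOfComplex
local notation "Δ" => ModularForm.discriminant

/-! ### Growth at the cusp, measured by powers of `|q|` -/

section Growth

/-- The real function `|q|^m = exp(-2π m Im τ)`. -/
noncomputable def qAbs (m : ℝ) (τ : ℍ) : ℝ := Real.exp (-(2 * Real.pi * m * τ.im))

lemma qAbs_pos (m : ℝ) (τ : ℍ) : 0 < qAbs m τ := Real.exp_pos _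

lemma qAbs_add (m n : ℝ) : qAbs (m + n) = fun τ => qAbs m τ * qAbs n τ := by
  ext τ
  rw [qAbs, qAbs, qAbs, ← Real.exp_add]
  ring_nf

lemma qAbs_zero : qAbs 0 = fun _ => 1 := by
  ext τ
  simp [qAbs]

lemma qAbs_natMul (n : ℕ) (m : ℝ) : qAbs (n * m) = fun τ => qAbs m τ ^ n := by
  ext τ
  rw [qAbs, qAbs, ← Real.exp_nat_mul]
  ring_nf

lemma qAbs_isBigO_of_le {m n : ℝ} (h : m ≤ n) : qAbs n =O[atImInfty] qAbs m := by
  refine .of_bound 1 (.of_forall fun τ => ?_)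
  rw [Real.norm_of_nonneg (qAbs_pos _ _).le, Real.norm_of_nonneg (qAbs_pos _ _).le, one_mul]
  refine Real.exp_le_exp.2 (neg_le_neg ?_)
  have := τ.im_pos
  have := Real.pi_pos
  gcongr

lemma qAbs_tendsto_zero {m : ℝ} (hm : 0 < m) : Tendsto (qAbs m) atImInfty (𝓝 0) := by
  have h : Tendsto UpperHalfPlane.im atImInfty atTop := tendsto_comap
  refine Real.tendsto_exp_neg_atTop_nhds_zero.comp ?_
  exact h.const_mul_atTop (by positivity)

instance : NeBot atImInfty := by
  refine comap_neBot fun s hs => ?_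
  obtain ⟨a, ha⟩ := mem_atTop_sets.1 hs
  exact ⟨⟨⟨0, max a 1⟩, lt_max_of_lt_right one_pos⟩, ha _ (le_max_left _ _)⟩

/-- `|q|^n = O(|q|^m)` at the cusp only if `m ≤ n`. -/
lemma le_of_qAbs_isBigO {m n : ℝ} (h : qAbs n =O[atImInfty] qAbs m) : m ≤ n := by
  by_contra! hlt
  have h1 : qAbs (m + (n - m)) =O[atImInfty] qAbs m := by rwa [add_sub_cancel]
  have h2 : (fun _ : ℍ => (1 : ℝ)) =O[atImInfty] qAbs (m - n) := by
    have := h.mul (isBigO_refl (qAbs (-n)) atImInfty)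
    rw [← qAbs_add, ← qAbs_add, add_neg_cancel, qAbs_zero] at this
    exact this
  have h3 := h2.trans_tendsto (qAbs_tendsto_zero (sub_pos.2 hlt))
  exact one_ne_zero (tendsto_nhds_unique tendsto_const_nhds h3)

lemma differentiableAt_ofComplex {f : ℍ → ℂ} (hf : MDiff f) {z : ℂ} (hz : 0 < z.im) :
    DifferentiableAt ℂ (f ∘ ofComplex) z :=
  mdifferentiableAt_iff.mp (hf ⟨z, hz⟩)

/-- Cauchy's estimate on the unit disc about `τ`: there the imaginary part moves by at most `1`, so
`|q|^m` changes by a factor of at most `exp(2π|m|)`. Starting at height `max A 0 + 2` keeps the disc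
inside `ℍ` and in the region where the bound on `f` holds. -/
lemma isBigO_normalizedDeriv {f : ℍ → ℂ} (hf : MDiff f) {m : ℝ} (h : f =O[atImInfty] qAbs m) :
    𝒟₁ f =O[atImInfty] qAbs m := by
  obtain ⟨C, hC, hCf⟩ := h.exists_nonneg
  obtain ⟨A, hA⟩ := (atImInfty_mem _).1 hCf.bound
  refine .of_bound (‖(2 * Real.pi * Complex.I)⁻¹‖ * (C * Real.exp (2 * Real.pi * |m|)))
    ((atImInfty_mem _).2 ⟨max A 0 + 2, fun τ hτ => ?_⟩)
  have hball : ∀ z ∈ Metric.closedBall (τ : ℂ) 1, |z.im - τ.im| ≤ 1 := fun z hz => by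
    have := (abs_im_le_norm (z - τ)).trans (mem_closedBall_iff_norm.1 hz)
    simpa using this
  have him : ∀ z ∈ Metric.closedBall (τ : ℂ) 1, max A 0 + 1 ≤ z.im := fun z hz => by
    have := abs_le.1 (hball z hz)
    linarith
  have hd : ‖deriv (f ∘ ofComplex) τ‖ ≤ C * Real.exp (2 * Real.pi * |m|) * qAbs m τ / 1 := by
    refine norm_deriv_le_of_forall_mem_sphere_norm_le one_pos ?_ fun z hz => ?_
    · refine DifferentiableOn.diffContOnCl fun z hz => ?_
      rw [closure_ball _ one_ne_zero] at hz
      refine (differentiableAt_ofComplex hf ?_).differentiableWithinAt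
      have := him z hz
      have := le_max_right A 0
      linarith
    · have hz := Metric.sphere_subset_closedBall hz
      have h1 := him z hz
      have hpos : 0 < z.im := by
        have := le_max_right A 0
        linarith
      have h2 : ‖f ⟨z, hpos⟩‖ ≤ C * ‖qAbs m ⟨z, hpos⟩‖ := hA ⟨z, hpos⟩ (by
        have := le_max_left A 0
        change A ≤ z.im
        linarith)
      rw [Function.comp_apply, ofComplex_apply_of_im_pos hpos]
      refine h2.trans ?_
      rw [mul_assoc, Real.norm_of_nonneg (qAbs_pos _ _).le, qAbs, qAbs, ← Real.exp_add]
      refine mul_le_mul_of_nonneg_left (Real.exp_le_exp.2 ?_) hC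
      have h3 : m * (τ.im - z.im) ≤ |m| := by
        calc m * (τ.im - z.im) ≤ |m * (τ.im - z.im)| := le_abs_self _
          _ = |m| * |z.im - τ.im| := by rw [abs_mul, abs_sub_comm]
          _ ≤ |m| * 1 := mul_le_mul_of_nonneg_left (hball z hz) (abs_nonneg _)
          _ = |m| := mul_one _
      change -(2 * Real.pi * m * z.im) ≤ _
      nlinarith [Real.pi_pos]
  rw [div_one] at hd
  change ‖(2 * Real.pi * Complex.I)⁻¹ * deriv (f ∘ ofComplex) τ‖ ≤ _ * ‖qAbs m τ‖
  rw [norm_mul, Real.norm_of_nonneg (qAbs_pos m τ).le]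
  exact (mul_le_mul_of_nonneg_left hd (norm_nonneg _)).trans_eq (mul_assoc _ _ _).symm

lemma mdiff_iterate_normalizedDeriv {f : ℍ → ℂ} (hf : MDiff f) (a : ℕ) : MDiff (𝒟₁^[a] f) := by
  induction a with
  | zero => exact hf
  | succ a ih =>
    rw [Function.iterate_succ_apply']
    exact normalizedDerivOfComplex_mdifferentiable ih

lemma isBigO_iterate_normalizedDeriv {f : ℍ → ℂ} (hf : MDiff f) {m : ℝ}
    (h : f =O[atImInfty] qAbs m) (a : ℕ) : 𝒟₁^[a] f =O[atImInfty] qAbs m := by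
  induction a with
  | zero => exact h
  | succ a ih =>
    rw [Function.iterate_succ_apply']
    exact isBigO_normalizedDeriv (mdiff_iterate_normalizedDeriv hf a) ih

end Growth

/-! ### Eisenstein series and their Rankin–Cohen bracket -/

section Eisenstein

lemma mdiff_discriminant : MDiff Δ := CuspForm.discriminant.holo'

lemma discriminant_slash (γ : SL(2, ℤ)) : Δ ∣[(12 : ℤ)] γ = Δ :=
  CuspForm.discriminant.slash_action_eq' _ ⟨γ, rfl⟩

lemma levelOne_slash {k : ℤ} (f : ModularForm 𝒮ℒ k) (γ : SL(2, ℤ)) : (f : ℍ → ℂ) ∣[k] γ = f :=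
  f.slash_action_eq' _ ⟨γ, rfl⟩

lemma isBigO_sub_valueAtInfty {k : ℤ} (f : ModularForm 𝒮ℒ k) :
    (fun τ => f τ - valueAtInfty f) =O[atImInfty] qAbs 1 := by
  have := UpperHalfPlane.exp_decay_sub_atImInfty (h := 1) (f := f) one_pos
    (by simpa using SlashInvariantFormClass.periodic_comp_ofComplex f one_mem_strictPeriods_SL)
    f.holo' (ModularFormClass.bdd_at_infty f)
  convert this using 2 with τ
  rw [qAbs]
  ring_nf

lemma isBigO_normalizedDeriv_levelOne {k : ℤ} (f : ModularForm 𝒮ℒ k) :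
    𝒟₁ f =O[atImInfty] qAbs 1 := by
  have h := isBigO_normalizedDeriv (f := fun τ => f τ - valueAtInfty f)
    (f.holo'.sub mdifferentiable_const) (isBigO_sub_valueAtInfty f)
  convert h using 1
  have := Derivative.normalizedDerivOfComplex_sub f (fun _ => valueAtInfty f) f.holo'
    mdifferentiable_const
  rw [Derivative.normalizedDerivOfComplex_const, sub_zero] at this
  exact this.symm

lemma tendsto_valueAtInfty {k : ℤ} (f : ModularForm 𝒮ℒ k) :
    Tendsto f atImInfty (𝓝 (valueAtInfty f)) := by
  have := (isBigO_sub_valueAtInfty f).trans_tendsto (qAbs_tendsto_zero one_pos)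
  simpa using this.add_const (valueAtInfty f)

lemma valueAtInfty_eq_coeff {k : ℤ} (f : ModularForm 𝒮ℒ k) :
    valueAtInfty f = (qExpansion 1 f).coeff 0 :=
  (qExpansion_coeff_zero one_pos
    (ModularFormClass.analyticAt_cuspFunction_zero f one_pos one_mem_strictPeriods_SL)
    (by simpa using
      SlashInvariantFormClass.periodic_comp_ofComplex f one_mem_strictPeriods_SL)).symm

lemma E_tendsto {k : ℕ} (hk : 3 ≤ k) (hk2 : Even k) :
    Tendsto (E hk) atImInfty (𝓝 1) := by
  have := tendsto_valueAtInfty (E hk)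
  rwa [valueAtInfty_eq_coeff, EisensteinSeries.E_qExpansion_coeff_zero hk hk2] at this

/-- The Rankin–Cohen bracket of `E₄` and `E₆` is a multiple of the discriminant. -/
lemma exists_bracket_eq : ∃ c : ℂ, ∀ τ,
    4 * E₄ τ * 𝒟₁ E₆ τ - 6 * E₆ τ * 𝒟₁ E₄ τ = c * Δ τ := by
  let g : ℍ → ℂ := fun τ => 4 * E₄ τ * 𝒟₁ E₆ τ - 6 * E₆ τ * 𝒟₁ E₄ τ
  have hg : ∀ γ : SL(2, ℤ), g ∣[(12 : ℤ)] γ = g := fun γ => by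
    have h4 : serreDerivative (4 : ℤ) E₄ ∣[(4 + 2 : ℤ)] γ = serreDerivative (4 : ℤ) E₄ :=
      Derivative.serreDerivative_slash_invariant E₄.holo' (levelOne_slash E₄ γ)
    have h6 : serreDerivative (6 : ℤ) E₆ ∣[(6 + 2 : ℤ)] γ = serreDerivative (6 : ℤ) E₆ :=
      Derivative.serreDerivative_slash_invariant E₆.holo' (levelOne_slash E₆ γ)
    -- Serre derivatives may replace `𝒟₁`: the two `E₂` terms are both `2 E₂ E₄ E₆` and cancel.
    have e : g = (4 : ℂ) • (E₄ * serreDerivative (6 : ℤ) E₆)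
        - (6 : ℂ) • (E₆ * serreDerivative (4 : ℤ) E₄) := by
      ext τ
      simp [g]
      ring
    rw [e, sub_eq_add_neg, SlashAction.add_slash, SlashAction.neg_slash,
      ModularForm.SL_smul_slash, ModularForm.SL_smul_slash]
    have m1 := ModularForm.mul_slash_SL2 4 (6 + 2) γ E₄ (serreDerivative (6 : ℤ) E₆)
    have m2 := ModularForm.mul_slash_SL2 6 (4 + 2) γ E₆ (serreDerivative (4 : ℤ) E₄)
    rw [h6, levelOne_slash] at m1
    rw [h4, levelOne_slash] at m2
    exact congrArg₂ _ (congrArg _ m1) (congrArg _ (congrArg _ m2))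
  let G : CuspForm 𝒮ℒ 12 :=
    { toFun := g
      slash_action_eq' := fun _ ⟨γ, hγ⟩ => hγ ▸ hg γ
      holo' := by
        have h4 := normalizedDerivOfComplex_mdifferentiable E₄.holo'
        have h6 := normalizedDerivOfComplex_mdifferentiable E₆.holo'
        exact ((mdifferentiable_const.mul E₄.holo').mul h6).sub
          ((mdifferentiable_const.mul E₆.holo').mul h4)
      zero_at_cusps' := fun {c} hc => by
        rw [Subgroup.IsArithmetic.isCusp_iff_isCusp_SL2Z] at hc
        rw [OnePoint.isZeroAt_iff_forall_SL2Z hc]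
        intro γ _
        rw [hg]
        have t4 := (isBigO_normalizedDeriv_levelOne E₄).trans_tendsto (qAbs_tendsto_zero one_pos)
        have t6 := (isBigO_normalizedDeriv_levelOne E₆).trans_tendsto (qAbs_tendsto_zero one_pos)
        have := (((E_tendsto (by norm_num) ⟨2, rfl⟩).const_mul 4).mul t6).sub
          (((E_tendsto (by norm_num) ⟨3, rfl⟩).const_mul 6).mul t4)
        rw [mul_zero, mul_zero, sub_zero] at this
        exact this }
  obtain ⟨c, hc⟩ := CuspForm.exists_smul_discriminant_of_weight_eq_twelve G
  exact ⟨c, fun τ => (DFunLike.congr_fun hc τ).symm⟩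

end Eisenstein

/-! ### Holomorphic functions on the upper half-plane -/

section Analytic

lemma analyticOnNhd_ofComplex {f : ℍ → ℂ} (hf : MDiff f) :
    AnalyticOnNhd ℂ (f ∘ ofComplex) upperHalfPlaneSet :=
  (UpperHalfPlane.mdifferentiable_iff.mp hf).analyticOnNhd isOpen_upperHalfPlaneSet

lemma analyticAt_ofComplex {f : ℍ → ℂ} (hf : MDiff f) (τ : ℍ) :
    AnalyticAt ℂ (f ∘ ofComplex) τ :=
  analyticOnNhd_ofComplex hf τ τ.im_pos

lemma isPreconnected_upperHalfPlaneSet : IsPreconnected upperHalfPlaneSet :=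
  (convex_halfSpace_im_gt 0).isPreconnected

lemma tendsto_ofComplex (τ : ℍ) : Tendsto ofComplex (𝓝 (τ : ℂ)) (𝓝 τ) := by
  have := (mdifferentiableAt_ofComplex τ.im_pos).continuousAt
  rwa [ContinuousAt, ofComplex_apply] at this

lemma eq_of_eventuallyEq {f g : ℍ → ℂ} (hf : MDiff f) (hg : MDiff g) {τ : ℍ}
    (h : f ∘ ofComplex =ᶠ[𝓝 (τ : ℂ)] g ∘ ofComplex) : f = g := by
  ext z
  simpa using (analyticOnNhd_ofComplex hf).eqOn_of_preconnected_of_eventuallyEq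
    (analyticOnNhd_ofComplex hg) isPreconnected_upperHalfPlaneSet τ.im_pos h z.im_pos

lemma eq_const_of_normalizedDeriv_eq_zero {f : ℍ → ℂ} (hf : MDiff f) (h : 𝒟₁ f = 0) :
    ∃ c, f = fun _ => c := by
  obtain ⟨c, hc⟩ := isOpen_upperHalfPlaneSet.exists_is_const_of_deriv_eq_zero
    isPreconnected_upperHalfPlaneSet (UpperHalfPlane.mdifferentiable_iff.mp hf) fun z hz => by
      have := congrFun h ⟨z, hz⟩
      simpa [normalizedDerivOfComplex] using this
  exact ⟨c, funext fun τ => by simpa using hc τ τ.im_pos⟩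

lemma exists_nhds_injOn {f : ℂ → ℂ} {a : ℂ} (hf : AnalyticAt ℂ f a) (h : deriv f a ≠ 0) :
    ∃ U ∈ 𝓝 a, Set.InjOn f U := by
  refine ⟨_, hf.hasStrictDerivAt.eventually_left_inverse h, fun x hx y hy hxy => ?_⟩
  rw [← hx, ← hy, hxy]

/-- A nonconstant holomorphic function on the upper half-plane is open. -/
lemma nhds_le_map {f : ℍ → ℂ} (hf : MDiff f) (hc : ∀ c, f ≠ fun _ => c) (τ : ℍ) :
    𝓝 (f τ) ≤ map f (𝓝 τ) := by
  rcases (analyticAt_ofComplex hf τ).eventually_constant_or_nhds_le_map_nhds with h | h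
  · refine absurd (eq_of_eventuallyEq (τ := τ) hf mdifferentiable_const ?_) (hc (f τ))
    rw [Function.comp_apply, ofComplex_apply] at h
    exact h
  · rw [Function.comp_apply, ofComplex_apply, ← map_map] at h
    exact h.trans (map_mono (tendsto_ofComplex τ))

end Analytic

/-! ### Closedness of the orbit relation -/

section Equivalence

lemma orbitRel_range_iff (τ τ' : ℍ) :
    MulAction.orbitRel 𝒮ℒ ℍ τ τ' ↔ MulAction.orbitRel SL(2, ℤ) ℍ τ τ' := by
  simp only [MulAction.orbitRel_apply, MulAction.mem_orbit_iff]
  constructor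
  · rintro ⟨⟨_, γ, rfl⟩, h⟩
    exact ⟨γ, h⟩
  · rintro ⟨γ, h⟩
    exact ⟨⟨_, γ, rfl⟩, h⟩

/-- The action is properly discontinuous, so the quotient is Hausdorff, and the relation is the
preimage of its diagonal. -/
lemma isClosed_orbitRel : IsClosed {p : ℍ × ℍ | MulAction.orbitRel SL(2, ℤ) ℍ p.1 p.2} := by
  have : T2Space (Quotient (MulAction.orbitRel 𝒮ℒ ℍ)) :=
    t2Space_of_properlyDiscontinuousSMul_of_t2Space
  have h := isClosed_eq
    ((continuous_quotient_mk' (s := MulAction.orbitRel 𝒮ℒ ℍ)).comp (continuous_fst (Y := ℍ)))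
    ((continuous_quotient_mk' (s := MulAction.orbitRel 𝒮ℒ ℍ)).comp continuous_snd)
  convert h using 2
  ext p
  rw [← orbitRel_range_iff]
  exact Quotient.eq.symm

lemma continuous_SL_smul (γ : SL(2, ℤ)) : Continuous fun τ : ℍ => γ • τ :=
  continuous_const_smul (γ : GL (Fin 2) ℝ)

end Equivalence

/-! ### The modular invariant and its derivative -/

section JInvariant

lemma E₄_cube_sub_E₆_sq (τ : ℍ) : E₄ τ ^ 3 - E₆ τ ^ 2 = 1728 * Δ τ := by
  rw [discriminant_eq_E₄_cube_sub_E₆_sq]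
  ring

/-- The modular invariant `j = E₄³/Δ`. -/
noncomputable def jInv (τ : ℍ) : ℂ := E₄ τ ^ 3 / Δ τ

lemma mdiff_jInv : MDiff jInv :=
  (E₄.holo'.pow 3).div mdiff_discriminant discriminant_ne_zero

lemma denom_ne_zero' (γ : SL(2, ℤ)) (τ : ℍ) : ((γ 1 0 : ℤ) : ℂ) * τ + (γ 1 1 : ℤ) ≠ 0 := by
  simpa [denom] using denom_ne_zero (γ : GL (Fin 2) ℝ) τ

lemma levelOne_smul {k : ℤ} (f : ModularForm 𝒮ℒ k) (γ : SL(2, ℤ)) (τ : ℍ) :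
    f (γ • τ) = (((γ 1 0 : ℤ) : ℂ) * τ + (γ 1 1 : ℤ)) ^ k * f τ :=
  (slash_action_eq'_iff k f γ τ).1 (congrFun (levelOne_slash f γ) τ)

lemma discriminant_smul (γ : SL(2, ℤ)) (τ : ℍ) :
    Δ (γ • τ) = (((γ 1 0 : ℤ) : ℂ) * τ + (γ 1 1 : ℤ)) ^ (12 : ℤ) * Δ τ :=
  (slash_action_eq'_iff 12 Δ γ τ).1 (congrFun (discriminant_slash γ) τ)

lemma jInv_smul (γ : SL(2, ℤ)) (τ : ℍ) : jInv (γ • τ) = jInv τ := by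
  have h := denom_ne_zero' γ τ
  have h2 := discriminant_ne_zero τ
  rw [jInv, jInv, levelOne_smul, discriminant_smul]
  field_simp

lemma jInv_ne_const (c : ℂ) : jInv ≠ fun _ => c := by
  intro h
  have h1 : ∀ τ, E₄ τ ^ 3 = c * Δ τ := fun τ => by
    have := congrFun h τ
    rwa [jInv, div_eq_iff (discriminant_ne_zero τ)] at this
  have h2 := (E_tendsto (k := 4) (by norm_num) ⟨2, rfl⟩).pow 3
  have h3 : Tendsto (fun τ => c * Δ τ) atImInfty (𝓝 (c * 0)) :=
    Tendsto.const_mul c discriminant_isZeroAtImInfty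
  have := tendsto_nhds_unique (h2.congr h1) h3
  simp at this

/-- `D j` is a nonzero multiple of `E₄² E₆ / Δ`. -/
lemma exists_bracket_ne_zero : ∃ c : ℂ, c ≠ 0 ∧
    (∀ τ, 4 * E₄ τ * 𝒟₁ E₆ τ - 6 * E₆ τ * 𝒟₁ E₄ τ = c * Δ τ) ∧
    ∀ τ, 𝒟₁ jInv τ = c / 3456 * (E₄ τ ^ 2 * E₆ τ / Δ τ) := by
  obtain ⟨c, hc⟩ := exists_bracket_eq
  have hJ : ∀ τ, 𝒟₁ jInv τ = c / 3456 * (E₄ τ ^ 2 * E₆ τ / Δ τ) := fun τ => by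
    have e1 : jInv * Δ = E₄ ^ 3 := by
      ext τ
      simp [jInv, div_mul_cancel₀ _ (discriminant_ne_zero τ)]
    have e2 : (E₄ : ℍ → ℂ) ^ 3 - E₆ ^ 2 = (1728 : ℂ) • Δ := by
      ext τ
      simpa using E₄_cube_sub_E₆_sq τ
    have m4 : MDiff (E₄ : ℍ → ℂ) := E₄.holo'
    have m6 : MDiff (E₆ : ℍ → ℂ) := E₆.holo'
    have d1 := congrFun (congrArg 𝒟₁ e1) τ
    have d2 := congrFun (congrArg 𝒟₁ e2) τ
    rw [normalizedDerivOfComplex_mul _ _ mdiff_jInv mdiff_discriminant,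
      normalizedDerivOfComplex_pow _ _ m4] at d1
    rw [Derivative.normalizedDerivOfComplex_sub _ _ (m4.pow 3) (m6.pow 2),
      normalizedDerivOfComplex_pow _ _ m4, normalizedDerivOfComplex_pow _ _ m6,
      Derivative.normalizedDerivOfComplex_smul _ _ mdiff_discriminant] at d2
    simp only [Pi.add_apply, Pi.mul_apply, Pi.pow_apply, Pi.sub_apply, Pi.smul_apply,
      Pi.natCast_apply, smul_eq_mul] at d1 d2
    push_cast at d1 d2
    norm_num at d1 d2
    have h0 := discriminant_ne_zero τ
    have h1 := E₄_cube_sub_E₆_sq τ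
    have h2 := hc τ
    have h3 : jInv τ * Δ τ = E₄ τ ^ 3 := congrFun e1 τ
    rw [mul_div_assoc', eq_div_iff h0]
    refine mul_right_cancel₀ h0 ?_
    -- Differentiating `j Δ = E₄³` and `E₄³ - E₆² = 1728 Δ` and eliminating `𝒟₁ Δ` leaves the
    -- bracket as the only derivative.
    linear_combination Δ τ * d1 - 𝒟₁ Δ τ * h3 + E₄ τ ^ 3 / 1728 * d2
      - 3 * E₄ τ ^ 2 * 𝒟₁ E₄ τ / 1728 * h1 + E₄ τ ^ 2 * E₆ τ / 3456 * h2
  refine ⟨c, ?_, hc, hJ⟩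
  -- With `c = 0` the derivative of `j` would vanish and `j` would be constant.
  rintro rfl
  obtain ⟨a, ha⟩ := eq_const_of_normalizedDeriv_eq_zero mdiff_jInv (funext fun τ => by simp [hJ])
  exact jInv_ne_const a ha

lemma jInv_eq_zero_iff (τ : ℍ) : jInv τ = 0 ↔ E₄ τ = 0 := by
  simp [jInv, discriminant_ne_zero]

lemma jInv_sub (τ : ℍ) : jInv τ - 1728 = E₆ τ ^ 2 / Δ τ := by
  have h := E₄_cube_sub_E₆_sq τ
  have h0 := discriminant_ne_zero τ
  rw [jInv]
  field_simp
  linear_combination h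

lemma jInv_eq_1728_iff (τ : ℍ) : jInv τ = 1728 ↔ E₆ τ = 0 := by
  rw [← sub_eq_zero, jInv_sub]
  simp [discriminant_ne_zero]

lemma deriv_jInv_ne_zero {τ : ℍ} (h0 : jInv τ ≠ 0) (h1 : jInv τ ≠ 1728) :
    deriv (jInv ∘ ofComplex) τ ≠ 0 := by
  obtain ⟨c, hc, -, h⟩ := exists_bracket_ne_zero
  intro hd
  have := h τ
  rw [normalizedDerivOfComplex, hd, mul_zero, eq_comm] at this
  rw [Ne, jInv_eq_zero_iff] at h0
  rw [Ne, jInv_eq_1728_iff] at h1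
  simp [hc, h0, h1, discriminant_ne_zero] at this

end JInvariant

/-! ### Injectivity of `j` on orbits -/

section Injectivity

lemma tendsto_norm_jInv : Tendsto (fun τ => ‖jInv τ‖) atImInfty atTop := by
  have h1 : Tendsto (fun τ => ‖Δ τ‖) atImInfty (𝓝[>] 0) := by
    refine tendsto_nhdsWithin_iff.2 ⟨?_, .of_forall fun τ => norm_pos_iff.2 (discriminant_ne_zero τ)⟩
    have h : Tendsto Δ atImInfty (𝓝 0) := discriminant_isZeroAtImInfty
    simpa using h.norm
  have h2 := ((E_tendsto (k := 4) (by norm_num) ⟨2, rfl⟩).pow 3).norm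
  rw [one_pow, norm_one] at h2
  refine (h2.pos_mul_atTop one_pos (tendsto_inv_nhdsGT_zero.comp h1)).congr fun τ => ?_
  simp [jInv, div_eq_mul_inv]

lemma cuspFunction_qParam {k : ℤ} (f : ModularForm 𝒮ℒ k) (τ : ℍ) :
    cuspFunction 1 f (Function.Periodic.qParam 1 τ) = f τ :=
  SlashInvariantFormClass.eq_cuspFunction f τ one_mem_strictPeriods_SL one_ne_zero

lemma cuspFunction_discriminant_qParam (τ : ℍ) :
    cuspFunction 1 Δ (Function.Periodic.qParam 1 τ) = Δ τ :=
  SlashInvariantFormClass.eq_cuspFunction CuspForm.discriminant τ one_mem_strictPeriods_SL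
    one_ne_zero

lemma orbitRel_of_qParam_eq {τ τ' : ℍ}
    (h : Function.Periodic.qParam 1 (τ : ℂ) = Function.Periodic.qParam 1 (τ' : ℂ)) :
    MulAction.orbitRel SL(2, ℤ) ℍ τ τ' := by
  obtain ⟨n, hn⟩ := Complex.exp_eq_exp_iff_exists_int.1 h
  refine ⟨ModularGroup.T ^ n, UpperHalfPlane.coe_inj.1 ?_⟩
  change ((ModularGroup.T ^ n • τ' : ℍ) : ℂ) = τ
  rw [ModularGroup.coe_T_zpow_smul_eq]
  refine mul_left_cancel₀ Complex.two_pi_I_ne_zero ?_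
  simp only [ofReal_one, div_one] at hn
  linear_combination -hn

lemma orbitRel_of_smul {τ τ' : ℍ} (γ γ' : SL(2, ℤ))
    (h : MulAction.orbitRel SL(2, ℤ) ℍ (γ • τ) (γ' • τ')) :
    MulAction.orbitRel SL(2, ℤ) ℍ τ τ' := by
  obtain ⟨δ, hδ⟩ := h
  refine ⟨γ⁻¹ * δ * γ', ?_⟩
  change δ • γ' • τ' = γ • τ at hδ
  change (γ⁻¹ * δ * γ') • τ' = τ
  rw [mul_smul, mul_smul, hδ, inv_smul_smul]

/-- The modular invariant separates orbits near the cusp. -/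
lemma exists_jInv_separates_cusp : ∃ Y : ℝ, ∀ τ τ' : ℍ, Y ≤ τ.im → Y ≤ τ'.im →
    jInv τ = jInv τ' → MulAction.orbitRel SL(2, ℤ) ℍ τ τ' := by
  -- `u` is `1/j` as a function of `q`. It is analytic at `q = 0` with derivative `1`, hence
  -- injective near the cusp, and points with equal `q` differ by an integer translation.
  set u : ℂ → ℂ := fun q => cuspFunction 1 Δ q / cuspFunction 1 E₄ q ^ 3 with hu
  have a1 : AnalyticAt ℂ (cuspFunction 1 Δ) 0 :=
    ModularFormClass.analyticAt_cuspFunction_zero CuspForm.discriminant one_pos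
      one_mem_strictPeriods_SL
  have a4 : AnalyticAt ℂ (cuspFunction 1 E₄) 0 :=
    ModularFormClass.analyticAt_cuspFunction_zero E₄ one_pos one_mem_strictPeriods_SL
  have v4 : cuspFunction 1 E₄ 0 = 1 := by
    have := EisensteinSeries.E_qExpansion_coeff_zero (k := 4) (by norm_num) ⟨2, rfl⟩
    simpa [qExpansion_coeff] using this
  have v1 : cuspFunction 1 Δ 0 = 0 := discriminant_isZeroAtImInfty.cuspFunction_apply_zero one_pos
  have d1 : deriv (cuspFunction 1 Δ) 0 = 1 := by
    simpa [qExpansion_coeff] using discriminant_qExpansion_coeff_one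
  have au : AnalyticAt ℂ u 0 := a1.div (a4.pow 3) (by simp [v4])
  have du : deriv u 0 ≠ 0 := by
    have := a1.differentiableAt.hasDerivAt.div (a4.differentiableAt.hasDerivAt.pow 3)
      (by simp [v4])
    have e : deriv u 0 = _ := this.deriv
    simp [e, v1, v4, d1]
  obtain ⟨U, hU, hinj⟩ := exists_nhds_injOn au du
  obtain ⟨Y, hY⟩ := (atImInfty_mem _).1 (qParam_tendsto_atImInfty one_pos hU)
  refine ⟨Y, fun τ τ' h h' hj => orbitRel_of_qParam_eq (hinj (hY τ h) (hY τ' h') ?_)⟩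
  have e : ∀ z : ℍ, u (Function.Periodic.qParam 1 z) = (jInv z)⁻¹ := fun z => by
    simp only [hu, cuspFunction_qParam, cuspFunction_discriminant_qParam, jInv, inv_div]
  rw [e, e, hj]

/-- The values taken by the modular invariant on at least two orbits. -/
def jMultiple : Set ℂ :=
  {c | ∃ τ τ' : ℍ, jInv τ = c ∧ jInv τ' = c ∧ ¬ MulAction.orbitRel SL(2, ℤ) ℍ τ τ'}

/-- Inequivalence is an open condition on pairs, and `j` is an open map near each of the two
preimages. -/
lemma isOpen_jMultiple : IsOpen jMultiple := by
  refine isOpen_iff_mem_nhds.2 ?_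
  rintro c ⟨τ, τ', h, h', hR⟩
  have hn := isClosed_orbitRel.isOpen_compl.mem_nhds (x := (τ, τ')) hR
  rw [nhds_prod_eq] at hn
  obtain ⟨A, hA, A', hA', hAA⟩ := mem_prod_iff.1 hn
  have m := nhds_le_map mdiff_jInv jInv_ne_const τ (image_mem_map hA)
  have m' := nhds_le_map mdiff_jInv jInv_ne_const τ' (image_mem_map hA')
  rw [h] at m
  rw [h'] at m'
  filter_upwards [m, m']
  rintro _ ⟨z, hz, rfl⟩ ⟨z', hz', e⟩
  exact ⟨z, z', rfl, e, hAA (Set.mk_mem_prod hz hz')⟩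

lemma exists_smul_mem_truncated {Y : ℝ} {τ : ℍ} {c : ℝ} (hY : ∀ z : ℍ, Y ≤ z.im → c < ‖jInv z‖)
    (h : ‖jInv τ‖ ≤ c) :
    ∃ γ : SL(2, ℤ), γ • τ ∈ ModularGroup.truncatedFundamentalDomain Y := by
  obtain ⟨γ, hγ⟩ := ModularGroup.exists_smul_mem_fd τ
  refine ⟨γ, hγ, le_of_not_gt fun hlt => ?_⟩
  have := hY _ hlt.le
  rw [jInv_smul] at this
  linarith

/-- Inequivalent preimages of values `x n → c` can be moved into a compact truncated fundamental
domain, since `|j|` stays bounded, and they subconverge to `a`, `a'` over `c`. If `a = δ a'`, then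
near `a` there are two distinct points with the same value of `j`. This contradicts local
injectivity, as `j' ≠ 0` away from the values `0` and `1728`. -/
lemma jMultiple_closed_off : closure jMultiple ∩ {0, 1728}ᶜ ⊆ jMultiple := by
  rintro c ⟨hc, hc'⟩
  simp only [Set.mem_compl_iff, Set.mem_insert_iff, Set.mem_singleton_iff, not_or] at hc'
  obtain ⟨Y, hY⟩ := (atImInfty_mem _).1 (tendsto_norm_jInv.eventually_gt_atTop (‖c‖ + 1))
  obtain ⟨x, hx, hxc⟩ := mem_closure_iff_seq_limit.1
    (mem_closure_iff_nhds.2 fun t ht => mem_closure_iff_nhds.1 hc (t ∩ Metric.ball c 1)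
      (inter_mem ht (Metric.ball_mem_nhds c one_pos)) |>.mono fun y hy =>
        (⟨hy.1.1, hy.2, hy.1.2⟩ : y ∈ t ∩ (jMultiple ∩ Metric.ball c 1)))
  choose p p' hp hp' hR using fun n => (hx n).1
  have hle : ∀ n, ‖x n‖ ≤ ‖c‖ + 1 := fun n => by
    have h1 := mem_ball_iff_norm.1 (hx n).2
    have h2 := norm_sub_norm_le (x n) c
    linarith
  choose γ hγ using fun n => exists_smul_mem_truncated (τ := p n) hY (by rw [hp]; exact hle n)
  choose γ' hγ' using fun n => exists_smul_mem_truncated (τ := p' n) hY (by rw [hp']; exact hle n)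
  have hK := (ModularGroup.isCompact_truncatedFundamentalDomain Y).prod
    (ModularGroup.isCompact_truncatedFundamentalDomain Y)
  obtain ⟨⟨a, a'⟩, -, φ, hφ, hlim⟩ := hK.tendsto_subseq
    (x := fun n => (γ n • p n, γ' n • p' n)) fun n => ⟨hγ n, hγ' n⟩
  have l := (continuous_fst.tendsto _).comp hlim
  have l' := (continuous_snd.tendsto _).comp hlim
  simp only [Function.comp_def] at l l'
  have hcont : Continuous jInv := mdiff_jInv.continuous
  have hxφ := hxc.comp hφ.tendsto_atTop
  have ja : jInv a = c := by
    refine tendsto_nhds_unique ((hcont.tendsto a).comp l) (hxφ.congr fun n => ?_)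
    rw [Function.comp_apply, Function.comp_apply, jInv_smul, hp]
  have ja' : jInv a' = c := by
    refine tendsto_nhds_unique ((hcont.tendsto a').comp l') (hxφ.congr fun n => ?_)
    rw [Function.comp_apply, Function.comp_apply, jInv_smul, hp']
  refine ⟨a, a', ja, ja', fun hrel => ?_⟩
  obtain ⟨δ, hδ⟩ := hrel
  obtain ⟨U, hU, hinj⟩ := exists_nhds_injOn (analyticAt_ofComplex mdiff_jInv a)
    (deriv_jInv_ne_zero (by rw [ja]; exact hc'.1) (by rw [ja]; exact hc'.2))
  have l2 : Tendsto (fun n => δ • γ' (φ n) • p' (φ n)) atTop (𝓝 a) := by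
    have := ((continuous_SL_smul δ).tendsto a').comp l'
    rwa [show δ • a' = a from hδ] at this
  have hcoe : Continuous ((↑) : ℍ → ℂ) := isOpenEmbedding_coe.continuous
  obtain ⟨n, hn1, hn2⟩ := ((((hcoe.tendsto a).comp l).eventually hU).and
    (((hcoe.tendsto a).comp l2).eventually hU)).exists
  have := hinj hn1 hn2 (by
    simp only [Function.comp_apply, ofComplex_apply]
    rw [jInv_smul, jInv_smul, jInv_smul, hp, hp'])
  refine hR (φ n) (orbitRel_of_smul (γ (φ n)) (δ * γ' (φ n)) ?_)
  have e : γ (φ n) • p (φ n) = δ • γ' (φ n) • p' (φ n) := UpperHalfPlane.coe_inj.1 this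
  rw [mul_smul, ← e]

/-- The plane without `0` and `1728` is connected, so a nonempty `jMultiple`, open and relatively
closed there, would contain every other value. Values of large modulus are excluded: all their
preimages can be moved close to the cusp, where `j` separates orbits. -/
lemma jMultiple_eq_empty : jMultiple = ∅ := by
  have hcount : ({0, 1728} : Set ℂ).Countable := by simp
  have hcon := hcount.isConnected_compl_of_one_lt_rank (by simp [Complex.rank_real_complex])
  rw [← Set.not_nonempty_iff_eq_empty]
  intro hne
  have hne' : (({0, 1728} : Set ℂ)ᶜ ∩ jMultiple).Nonempty := by
    rw [Set.inter_comm]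
    exact (hcount.dense_compl ℂ).inter_open_nonempty _ isOpen_jMultiple hne
  have hsub := hcon.isPreconnected.subset_of_closure_inter_subset isOpen_jMultiple hne'
    jMultiple_closed_off
  obtain ⟨Y, hY⟩ := exists_jInv_separates_cusp
  obtain ⟨C, hC⟩ := (ModularGroup.isCompact_truncatedFundamentalDomain Y).exists_bound_of_continuousOn
    mdiff_jInv.continuous.continuousOn
  obtain ⟨z, hz⟩ := (tendsto_norm_jInv.eventually_gt_atTop (max C 1728)).exists
  have hz0 : jInv z ∈ ({0, 1728} : Set ℂ)ᶜ := by
    have h0 := (le_max_right C 1728).trans_lt hz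
    rintro (h | h) <;> rw [h] at h0 <;> norm_num at h0
  obtain ⟨p, p', hp, hp', hR⟩ := hsub hz0
  -- On the truncated domain `|j| ≤ C < |j z|`, so representatives of preimages of `j z` in the
  -- fundamental domain lie above height `Y`.
  have key : ∀ t : ℍ, jInv t = jInv z → ∃ γ : SL(2, ℤ), Y ≤ (γ • t).im := fun t ht => by
    obtain ⟨γ, hγ⟩ := ModularGroup.exists_smul_mem_fd t
    refine ⟨γ, le_of_not_gt fun hlt => ?_⟩
    have := hC _ ⟨hγ, hlt.le⟩
    rw [jInv_smul, ht] at this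
    exact absurd ((le_max_left C 1728).trans_lt hz) (not_lt.2 this)
  obtain ⟨γ, hγ⟩ := key p hp
  obtain ⟨γ', hγ'⟩ := key p' hp'
  exact hR (orbitRel_of_smul γ γ' (hY _ _ hγ hγ' (by rw [jInv_smul, jInv_smul, hp, hp'])))

/-- The modular invariant separates orbits. -/
theorem orbitRel_of_jInv_eq {τ τ' : ℍ} (h : jInv τ = jInv τ') :
    MulAction.orbitRel SL(2, ℤ) ℍ τ τ' := by
  by_contra hR
  have : jInv τ' ∈ jMultiple := ⟨τ, τ', h, rfl, hR⟩
  rw [jMultiple_eq_empty] at this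
  exact this

end Injectivity

/-! ### Level one forms as polynomials in `j` -/

section LevelOne

/-- A holomorphic modular form of weight `k` for `SL(2, ℤ)`, as a property of a function. -/
structure IsLevelOne (k : ℤ) (f : ℍ → ℂ) : Prop where
  holo : MDiff f
  slash : ∀ γ : SL(2, ℤ), f ∣[k] γ = f
  bdd : IsBoundedAtImInfty f

/-- The bundled modular form. -/
noncomputable def IsLevelOne.toForm {k : ℤ} {f : ℍ → ℂ} (hf : IsLevelOne k f) :
    ModularForm 𝒮ℒ k where
  toFun := f
  slash_action_eq' := fun _ ⟨γ, hγ⟩ => hγ ▸ hf.slash γ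
  holo' := hf.holo
  bdd_at_cusps' := fun {c} hc => by
    rw [Subgroup.IsArithmetic.isCusp_iff_isCusp_SL2Z] at hc
    rw [OnePoint.isBoundedAt_iff_forall_SL2Z hc]
    intro γ _
    rw [hf.slash]
    exact hf.bdd

lemma qAbs_one_isBigO_discriminant : qAbs 1 =O[atImInfty] Δ := by
  refine exp_isBigO_discriminant.congr_left fun τ => ?_
  rw [qAbs]
  ring_nf

lemma E₄_pow_slash (n : ℕ) (γ : SL(2, ℤ)) :
    ((E₄ : ℍ → ℂ) ^ n) ∣[(4 * n : ℤ)] γ = (E₄ : ℍ → ℂ) ^ n := by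
  ext τ
  rw [slash_action_eq'_iff]
  have := levelOne_smul E₄ γ τ
  simp only [Pi.pow_apply, this, mul_pow]
  rw [zpow_mul, zpow_natCast]

/-- A modular form of weight `12 K` is `Δ^K` times a polynomial in `j`. -/
theorem exists_polynomial (K : ℕ) {f : ℍ → ℂ} (hf : IsLevelOne (12 * K) f) :
    ∃ P : Polynomial ℂ, P.natDegree ≤ K ∧ ∀ τ, f τ = Δ τ ^ K * P.eval (jInv τ) := by
  induction K generalizing f with
  | zero =>
    have hf' : IsLevelOne 0 f := by simpa using hf
    obtain ⟨c, hc⟩ := ModularFormClass.levelOne_weight_zero_const hf'.toForm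
    refine ⟨Polynomial.C c, by simp, fun τ => ?_⟩
    rw [pow_zero, one_mul, Polynomial.eval_C]
    exact congrFun hc τ
  | succ K ih =>
    set c := valueAtInfty f with hc
    have h1 : (fun τ => f τ - c) =O[atImInfty] qAbs 1 := isBigO_sub_valueAtInfty hf.toForm
    have h4 : (fun τ => E₄ τ - 1) =O[atImInfty] qAbs 1 := by
      have := isBigO_sub_valueAtInfty E₄
      rwa [tendsto_nhds_unique (tendsto_valueAtInfty E₄)
        (E_tendsto (k := 4) (by norm_num) ⟨2, rfl⟩)] at this
    have h5 : (fun τ => E₄ τ ^ (3 * (K + 1)) - 1) =O[atImInfty] qAbs 1 := by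
      have hb : (fun τ => ∑ i ∈ Finset.range (3 * (K + 1)), E₄ τ ^ i)
          =O[atImInfty] fun _ => (1 : ℝ) := by
        refine Tendsto.isBigO_one ℝ (tendsto_finsetSum _ fun i _ =>
          (E_tendsto (k := 4) (by norm_num) ⟨2, rfl⟩).pow i)
      have := hb.mul h4
      simp only [one_mul] at this
      refine this.congr_left fun τ => ?_
      rw [mul_comm, mul_geom_sum]
    -- Removing `c E₄^{3(K+1)} = c Δ^{K+1} j^{K+1}` kills the constant term at the cusp, so division
    -- by `Δ` yields a bounded form of weight `12 K`.
    set g : ℍ → ℂ := (f - c • (E₄ : ℍ → ℂ) ^ (3 * (K + 1))) / Δ with hg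
    have hgO : g =O[atImInfty] fun _ => (1 : ℝ) := by
      have h6 : (f - c • (E₄ : ℍ → ℂ) ^ (3 * (K + 1))) =O[atImInfty] qAbs 1 := by
        refine (h1.sub (h5.const_mul_left c)).congr_left fun τ => ?_
        simp
        ring
      have h7 := (h6.trans qAbs_one_isBigO_discriminant)
      exact (div_isBoundedUnder_of_isBigO h7).isBigO_one ℝ
    have hgL : IsLevelOne (12 * K) g := by
      refine ⟨?_, fun γ => ?_, ?_⟩
      · exact (hf.holo.sub ((mdifferentiable_const (c := c)).mul (E₄.holo'.pow _))).div
          mdiff_discriminant discriminant_ne_zero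
      · have e : (12 * K : ℤ) = (12 * (K + 1 : ℕ) : ℤ) - 12 := by push_cast; ring
        have e' : (12 * (K + 1 : ℕ) : ℤ) = 4 * (3 * (K + 1) : ℕ) := by push_cast; ring
        rw [e, hg, div_slash_SL2, discriminant_slash, sub_eq_add_neg, SlashAction.add_slash,
          SlashAction.neg_slash, SL_smul_slash, hf.slash]
        rw [e', E₄_pow_slash]
      · exact hgO
    obtain ⟨P, hP, hPg⟩ := ih hgL
    refine ⟨Polynomial.C c * Polynomial.X ^ (K + 1) + P, ?_, fun τ => ?_⟩
    · refine Polynomial.natDegree_add_le_of_degree_le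
        (Polynomial.natDegree_C_mul_X_pow_le _ _) (hP.trans (Nat.le_succ K))
    · have h0 := discriminant_ne_zero τ
      have h8 : f τ = c * E₄ τ ^ (3 * (K + 1)) + Δ τ * g τ := by
        simp only [hg, Pi.div_apply, Pi.sub_apply, Pi.smul_apply, Pi.pow_apply, smul_eq_mul]
        field_simp
        ring
      rw [h8, hPg, pow_mul]
      simp only [Polynomial.eval_add, Polynomial.eval_mul, Polynomial.eval_C, Polynomial.eval_pow,
        Polynomial.eval_X, jInv, div_pow]
      field_simp
      ring

/-- The exact growth of `Δ^K P(j)` at the cusp. -/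
theorem qAbs_isBigO_of_polynomial {K : ℕ} {f : ℍ → ℂ} {P : Polynomial ℂ} (hP : P ≠ 0)
    (hK : P.natDegree ≤ K) (hf : ∀ τ, f τ = Δ τ ^ K * P.eval (jInv τ)) :
    qAbs (K - P.natDegree) =O[atImInfty] f := by
  set e := P.natDegree
  have hJ : Tendsto (fun τ => (jInv τ)⁻¹) atImInfty (𝓝 0) := by
    refine tendsto_zero_iff_norm_tendsto_zero.2 ?_
    simpa [Function.comp_def] using tendsto_inv_atTop_zero.comp tendsto_norm_jInv
  -- With `e = deg P`, `P(j) = j^e P.reverse(1/j)`, so `f = Δ^{K-e} (E₄³)^e P.reverse(1/j)`, and the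
  -- factors after `Δ^{K-e}` tend to the nonzero leading coefficient.
  have hR : Tendsto (fun τ => P.reverse.eval ((jInv τ)⁻¹)) atImInfty (𝓝 P.leadingCoeff) := by
    have := (P.reverse.continuous.tendsto 0).comp hJ
    rwa [← Polynomial.coeff_zero_eq_eval_zero, Polynomial.coeff_zero_reverse] at this
  have h1 : Tendsto (fun τ => (E₄ τ ^ 3) ^ e * P.reverse.eval ((jInv τ)⁻¹)) atImInfty
      (𝓝 P.leadingCoeff) := by
    simpa using (((E_tendsto (k := 4) (by norm_num) ⟨2, rfl⟩).pow 3).pow e).mul hR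
  have h2 : (fun _ => (1 : ℝ)) =O[atImInfty]
      fun τ => (E₄ τ ^ 3) ^ e * P.reverse.eval ((jInv τ)⁻¹) :=
    (isBigO_const_left_iff_pos_le_norm one_ne_zero).2 ⟨‖P.leadingCoeff‖ / 2, by
      have : 0 < ‖P.leadingCoeff‖ := by simpa using hP
      positivity, by
      have h3 : ‖P.leadingCoeff‖ / 2 < ‖P.leadingCoeff‖ := by
        have : 0 < ‖P.leadingCoeff‖ := by simpa using hP
        linarith
      exact (h1.norm.eventually (lt_mem_nhds h3)).mono fun _ h => h.le⟩
  have h3 := (qAbs_one_isBigO_discriminant.pow (K - e)).mul h2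
  refine (h3.congr' ?_ ?_)
  · refine .of_forall fun τ => ?_
    rw [← Nat.cast_sub hK, ← mul_one ((K - e : ℕ) : ℝ), qAbs_natMul]
    exact mul_one _
  · filter_upwards [tendsto_norm_jInv.eventually_gt_atTop 0] with τ hτ
    have hj : jInv τ ≠ 0 := norm_pos_iff.1 hτ
    have h0 := discriminant_ne_zero τ
    have h4 := invertibleOfNonzero hj
    have h5 := Polynomial.eval₂_reverse_mul_pow (RingHom.id ℂ) (jInv τ) P
    rw [invOf_eq_inv] at h5
    change P.reverse.eval ((jInv τ)⁻¹) * jInv τ ^ e = P.eval (jInv τ) at h5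
    have h6 : E₄ τ ^ 3 = jInv τ * Δ τ := by rw [jInv, div_mul_cancel₀ _ h0]
    rw [hf, ← h5, h6, mul_pow, ← Nat.sub_add_cancel hK, pow_add]
    simp only [Nat.add_sub_cancel]
    ring

end LevelOne

/-! ### Orders of vanishing and the elliptic points -/

section Orders

lemma analyticOrderAt_polynomial {P : Polynomial ℂ} (hP : P ≠ 0) (c : ℂ) :
    analyticOrderAt (fun z => P.eval z) c = P.rootMultiplicity c := by
  obtain ⟨Q, hQ, hd⟩ := P.exists_eq_pow_rootMultiplicity_mul_and_not_dvd hP c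
  refine (AnalyticAt.analyticOrderAt_eq_natCast ?_).2 ⟨fun z => Q.eval z, ?_, ?_, ?_⟩
  · exact AnalyticOnNhd.eval_polynomial P c (Set.mem_univ _)
  · exact AnalyticOnNhd.eval_polynomial Q c (Set.mem_univ _)
  · rwa [Polynomial.dvd_iff_isRoot] at hd
  · refine .of_forall fun z => ?_
    conv_lhs => rw [hQ]
    simp

/-- The multiplicity with which `j` takes its value at `τ`. -/
noncomputable def jMult (τ : ℍ) : ℕ := if E₄ τ = 0 then 3 else if E₆ τ = 0 then 2 else 1

lemma analyticOrderAt_eq_one_of_D_ne_zero {f : ℍ → ℂ} (hf : MDiff f) {τ : ℍ} (h0 : f τ = 0)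
    (h : 𝒟₁ f τ ≠ 0) : analyticOrderAt (f ∘ ofComplex) τ = 1 := by
  refine (analyticAt_ofComplex hf τ).analyticOrderAt_eq_one_of_zero_deriv_ne_zero (by simpa) ?_
  intro hd
  exact h (by rw [normalizedDerivOfComplex, hd, mul_zero])

lemma analyticOrderAt_eq_zero_of_ne_zero {f : ℍ → ℂ} (hf : MDiff f) {τ : ℍ} (h : f τ ≠ 0) :
    analyticOrderAt (f ∘ ofComplex) τ = 0 :=
  (analyticAt_ofComplex hf τ).analyticOrderAt_eq_zero.2 (by simpa)

lemma analyticOrderAt_eq_of_eq_pow_div {g f : ℍ → ℂ} {n : ℕ} (hf : MDiff f) {τ : ℍ}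
    (h0 : f τ = 0) (hD : 𝒟₁ f τ ≠ 0) (h : ∀ z, g z = f z ^ n / Δ z) :
    analyticOrderAt (g ∘ ofComplex) τ = n := by
  have e : g ∘ ofComplex = (f ∘ ofComplex) ^ n * ((fun z => (Δ z)⁻¹) ∘ ofComplex) := by
    ext z
    simp [h, div_eq_mul_inv]
  have hi : MDiff fun z => (Δ z)⁻¹ := by
    have := (mdifferentiable_const (c := (1 : ℂ))).div mdiff_discriminant discriminant_ne_zero
    simpa [Pi.div_def] using this
  rw [e, analyticOrderAt_mul ((analyticAt_ofComplex hf τ).pow n) (analyticAt_ofComplex hi τ),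
    analyticOrderAt_pow (analyticAt_ofComplex hf τ), analyticOrderAt_eq_one_of_D_ne_zero hf h0 hD,
    analyticOrderAt_eq_zero_of_ne_zero hi (inv_ne_zero (discriminant_ne_zero τ))]
  simp

/-- `j = E₄³/Δ` and `j - 1728 = E₆²/Δ`. Zeros of `E₄` and `E₆` are simple: at a multiple zero the
bracket would vanish, whereas it is a nonzero multiple of `Δ`. -/
lemma analyticOrderAt_jInv_sub (τ : ℍ) :
    analyticOrderAt (fun z => (jInv ∘ ofComplex) z - (jInv ∘ ofComplex) τ) τ = jMult τ := by
  obtain ⟨c, hc, hb, -⟩ := exists_bracket_ne_zero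
  have hb := hb τ
  have h0 := discriminant_ne_zero τ
  have e : (fun z => (jInv ∘ ofComplex) z - (jInv ∘ ofComplex) τ)
      = (fun z => jInv z - jInv τ) ∘ ofComplex := by
    ext z
    simp
  rw [jMult]
  split_ifs with h4 h6
  · rw [e]
    refine analyticOrderAt_eq_of_eq_pow_div (g := fun z => jInv z - jInv τ) (n := 3) E₄.holo' h4
      (fun hD => mul_ne_zero hc h0 ?_) fun z => ?_
    · rw [← hb]
      change 𝒟₁ E₄ τ = 0 at hD
      rw [h4, hD]
      ring
    · rw [(jInv_eq_zero_iff τ).2 h4, sub_zero]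
      rfl
  · rw [e]
    refine analyticOrderAt_eq_of_eq_pow_div (g := fun z => jInv z - jInv τ) (n := 2) E₆.holo' h6
      (fun hD => mul_ne_zero hc h0 ?_) fun z => ?_
    · rw [← hb]
      change 𝒟₁ E₆ τ = 0 at hD
      rw [h6, hD]
      ring
    · rw [(jInv_eq_1728_iff τ).2 h6, jInv_sub]
      rfl
  · exact (analyticAt_ofComplex mdiff_jInv τ).analyticOrderAt_sub_eq_one_of_deriv_ne_zero
      (deriv_jInv_ne_zero (by rwa [Ne, jInv_eq_zero_iff]) (by rwa [Ne, jInv_eq_1728_iff]))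

lemma ordAt_of_polynomial {K : ℕ} {f : ℍ → ℂ} {P : Polynomial ℂ} (hP : P ≠ 0)
    (hf : ∀ τ, f τ = Δ τ ^ K * P.eval (jInv τ)) (τ : ℍ) :
    ordAt f τ = P.rootMultiplicity (jInv τ) * jMult τ := by
  have e : f ∘ ofComplex = (Δ ∘ ofComplex) ^ K * ((fun z => P.eval z) ∘ (jInv ∘ ofComplex)) := by
    ext z
    simp [hf]
  have aP (c : ℂ) : AnalyticAt ℂ (fun z => P.eval z) c :=
    AnalyticOnNhd.eval_polynomial P c (Set.mem_univ _)
  have aJ := analyticAt_ofComplex mdiff_jInv τ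
  have aD := analyticAt_ofComplex mdiff_discriminant τ
  rw [ordAt, analyticOrderNatAt, e, analyticOrderAt_mul (aD.pow K) ((aP _).comp aJ),
    analyticOrderAt_pow aD, analyticOrderAt_eq_zero_of_ne_zero mdiff_discriminant
      (discriminant_ne_zero τ), (aP _).analyticOrderAt_comp aJ, analyticOrderAt_polynomial hP,
    analyticOrderAt_jInv_sub, Function.comp_apply, ofComplex_apply]
  simp

/-- `S` fixes `i` with automorphy factor `i^6 = -1`. -/
lemma E₆_I : E₆ UpperHalfPlane.I = 0 := by
  have h := levelOne_smul E₆ ModularGroup.S UpperHalfPlane.I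
  have e : ModularGroup.S • UpperHalfPlane.I = UpperHalfPlane.I := by
    rw [modular_S_smul]
    ext
    simp
  rw [e] at h
  simp [ModularGroup.S, zpow_ofNat] at h
  linear_combination h / 2

/-- `ST` fixes `ρ = e^{2πi/3}` with automorphy factor `(ρ + 1)^4 = ρ^8 = ρ² ≠ 1`. -/
lemma E₄_rhoPoint : E₄ rhoPoint = 0 := by
  have hr : (rhoPoint : ℂ) ^ 2 + rhoPoint + 1 = 0 := by
    have h3 : (rhoPoint : ℂ) ^ 3 = 1 := by
      change Complex.exp _ ^ 3 = 1
      rw [← Complex.exp_nat_mul, Complex.exp_eq_one_iff]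
      exact ⟨1, by push_cast; ring⟩
    have h1 : (rhoPoint : ℂ) - 1 ≠ 0 := fun h => by
      have := rhoPoint.im_pos
      rw [← coe_im, sub_eq_zero.1 h] at this
      simp at this
    refine (mul_eq_zero.1 ?_).resolve_left h1
    linear_combination h3
  have hr0 : (1 + (rhoPoint : ℂ)) ≠ 0 := fun h => by
    have := rhoPoint.im_pos
    rw [← coe_im, show (rhoPoint : ℂ) = -1 by linear_combination h] at this
    simp at this
  have e : (ModularGroup.S * ModularGroup.T) • rhoPoint = rhoPoint := by
    rw [mul_smul, modular_T_smul, modular_S_smul]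
    ext
    simp only [coe_vadd]
    push_cast
    refine inv_eq_of_mul_eq_one_right ?_
    linear_combination -hr
  have h := levelOne_smul E₄ (ModularGroup.S * ModularGroup.T) rhoPoint
  rw [e] at h
  rw [show (ModularGroup.S * ModularGroup.T) 1 0 = 1 by decide,
    show (ModularGroup.S * ModularGroup.T) 1 1 = 1 by decide, Int.cast_one, one_mul,
    show (rhoPoint : ℂ) + 1 = -(rhoPoint : ℂ) ^ 2 by linear_combination hr] at h
  have h2 : E₄ rhoPoint * ((rhoPoint : ℂ) ^ 2 - 1) = 0 := by
    norm_cast at h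
    have h3 : (rhoPoint : ℂ) ^ 3 = 1 := by linear_combination ((rhoPoint : ℂ) - 1) * hr
    linear_combination -h - E₄ rhoPoint * ((rhoPoint : ℂ) ^ 5 + (rhoPoint : ℂ) ^ 2) * h3
  refine (mul_eq_zero.1 h2).resolve_right fun h4 => ?_
  have h5 : (rhoPoint : ℂ) = -2 := by linear_combination hr - h4
  have := rhoPoint.im_pos
  rw [← coe_im, h5] at this
  simp at this

end Orders

/-! ### Counting zeros through the roots of `P` -/

section ZeroCount

lemma jInv_out (τ : ℍ) : jInv (orbitOf τ).out = jInv τ := by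
  obtain ⟨γ, hγ⟩ := MulAction.orbitRel_apply.1
    (Quotient.exact (Quotient.out_eq (orbitOf τ)) : MulAction.orbitRel SL(2, ℤ) ℍ _ τ)
  rw [← hγ]
  exact jInv_smul γ τ

lemma eq_of_jInv_out_eq {x y : MulAction.orbitRel.Quotient SL(2, ℤ) ℍ}
    (h : jInv x.out = jInv y.out) : x = y := by
  have := Quotient.sound (orbitRel_of_jInv_eq h)
  rwa [Quotient.out_eq, Quotient.out_eq] at this

lemma jInv_I : jInv UpperHalfPlane.I = 1728 := (jInv_eq_1728_iff _).2 E₆_I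

lemma jInv_rhoPoint : jInv rhoPoint = 0 := (jInv_eq_zero_iff _).2 E₄_rhoPoint

lemma jMult_I : jMult UpperHalfPlane.I = 2 := by
  have : E₄ UpperHalfPlane.I ≠ 0 := fun h => by
    have := (jInv_eq_zero_iff _).2 h
    rw [jInv_I] at this
    norm_num at this
  rw [jMult, if_neg this, if_pos E₆_I]

lemma jMult_rhoPoint : jMult rhoPoint = 3 := if_pos E₄_rhoPoint

lemma jMult_of_ne {τ : ℍ} (h0 : jInv τ ≠ 0) (h1 : jInv τ ≠ 1728) : jMult τ = 1 := by
  rw [Ne, jInv_eq_zero_iff] at h0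
  rw [Ne, jInv_eq_1728_iff] at h1
  rw [jMult, if_neg h0, if_neg h1]

/-- The number of zeros of `Δ^K P(j)` is at most the degree of `P`. -/
theorem zeroCount_le_natDegree {K : ℕ} {f : ℍ → ℂ} {P : Polynomial ℂ} (hP : P ≠ 0)
    (hf : ∀ τ, f τ = Δ τ ^ K * P.eval (jInv τ)) : zeroCount f ≤ P.natDegree := by
  classical
  set S : Set (MulAction.orbitRel.Quotient SL(2, ℤ) ℍ) :=
    {orbitOf UpperHalfPlane.I, orbitOf rhoPoint}ᶜ with hS
  have hSJ : ∀ x ∈ S, jInv x.out ≠ 0 ∧ jInv x.out ≠ 1728 := fun x hx => by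
    simp only [hS, Set.mem_compl_iff, Set.mem_insert_iff, Set.mem_singleton_iff, not_or] at hx
    refine ⟨fun h => hx.2 (eq_of_jInv_out_eq ?_), fun h => hx.1 (eq_of_jInv_out_eq ?_)⟩
    · rw [h, jInv_out, jInv_rhoPoint]
    · rw [h, jInv_out, jInv_I]
  have hord : ∀ x ∈ S, (ordAt f x.out : ℝ) = P.roots.count (jInv x.out) := fun x hx => by
    rw [ordAt_of_polynomial hP hf, jMult_of_ne (hSJ x hx).1 (hSJ x hx).2, mul_one,
      Polynomial.count_roots]
  have hfin : (S ∩ Function.support fun x => (ordAt f x.out : ℝ)).Finite := by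
    refine Set.Finite.of_finite_image (f := fun x => jInv x.out)
      (P.roots.toFinset.finite_toSet.subset ?_) fun x _ y _ h => eq_of_jInv_out_eq h
    rintro _ ⟨x, ⟨hx, hx'⟩, rfl⟩
    rw [Function.mem_support, hord x hx] at hx'
    simpa [Multiset.count_ne_zero, and_comm] using hx'
  -- Injectivity of `j` on orbits turns the sum over orbits into a sum over distinct roots.
  have hsum : ∑ᶠ x ∈ S, (ordAt f x.out : ℝ)
      = ∑ r ∈ hfin.toFinset.image (fun x => jInv x.out), (P.roots.count r : ℝ) := by
    rw [← finsum_mem_inter_support, finsum_mem_eq_finite_toFinset_sum _ hfin,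
      Finset.sum_image fun x _ y _ h => eq_of_jInv_out_eq h]
    refine Finset.sum_congr rfl fun x hx => hord x ?_
    exact ((Set.Finite.mem_toFinset hfin).1 hx).1
  -- The weights `1/2` and `1/3` cancel the multiplicities `2` and `3` of `j` at the elliptic
  -- points.
  have hI : (1 / 2 : ℝ) * (ordAt f UpperHalfPlane.I : ℝ) = P.roots.count 1728 := by
    rw [ordAt_of_polynomial hP hf, jMult_I, jInv_I, Polynomial.count_roots]
    push_cast
    ring
  have hρ : (1 / 3 : ℝ) * (ordAt f rhoPoint : ℝ) = P.roots.count 0 := by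
    rw [ordAt_of_polynomial hP hf, jMult_rhoPoint, jInv_rhoPoint, Polynomial.count_roots]
    push_cast
    ring
  rw [zeroCount, ← hS, hsum, hI, hρ]
  set T := hfin.toFinset.image (fun x => jInv x.out) with hT
  have hT' : ∀ r ∈ T, r ≠ 0 ∧ r ≠ 1728 := fun r hr => by
    obtain ⟨x, hx, rfl⟩ := Finset.mem_image.1 hr
    exact hSJ x ((Set.Finite.mem_toFinset hfin).1 hx).1
  have h1 : (1728 : ℂ) ∉ insert 0 T := by
    rw [Finset.mem_insert, not_or]
    exact ⟨by norm_num, fun h => (hT' _ h).2 rfl⟩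
  have h0 : (0 : ℂ) ∉ T := fun h => (hT' _ h).1 rfl
  have hle : ∑ r ∈ insert 1728 (insert 0 T), P.roots.count r ≤ P.natDegree := by
    refine le_trans ?_ P.card_roots'
    rw [← Multiset.sum_count_eq_card (s := insert 1728 (insert 0 T) ∪ P.roots.toFinset)
      fun a ha => Finset.mem_union_right _ (Multiset.mem_toFinset.2 ha)]
    exact Finset.sum_le_sum_of_subset Finset.subset_union_left
  rw [Finset.sum_insert h1, Finset.sum_insert h0] at hle
  have := (Nat.cast_le (α := ℝ)).2 hle
  push_cast at this
  linarith

end ZeroCount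

/-! ### The valence inequality -/

section Valence

lemma discriminant_isBigO : Δ =O[atImInfty] qAbs 1 := by
  have h := CuspFormClass.exp_decay_atImInfty (h := 1) CuspForm.discriminant one_pos
    one_mem_strictPeriods_SL
  refine h.congr_right fun τ => ?_
  rw [qAbs]
  ring_nf

lemma pow_slash (f : ℍ → ℂ) (k : ℤ) (n : ℕ) (γ : SL(2, ℤ)) :
    (f ^ n) ∣[(n * k : ℤ)] γ = (f ∣[k] γ) ^ n := by
  ext τ
  simp only [SL_slash_apply, Pi.pow_apply, mul_pow]
  rw [neg_mul_eq_mul_neg, mul_comm (n : ℤ), zpow_mul, zpow_natCast]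

lemma slash_neg_one (f : ℍ → ℂ) {k : ℤ} (hk : Even k) : f ∣[k] (-1 : SL(2, ℤ)) = f := by
  ext τ
  rw [SL_slash_apply, ModularGroup.SL_neg_smul, one_smul]
  simp [denom, hk.neg_one_zpow]

/-- The multipliers of a form of even weight on the generators of the modular group are twelfth
roots of unity. -/
lemma multiplier_pow_twelve {W : ℍ → ℂ} (hW0 : W ≠ 0) {k : ℤ} (hk : Even k) {s t : ℂ}
    (hS : W ∣[k] ModularGroup.S = s • W) (hT : W ∣[k] ModularGroup.T = t • W) :
    s ^ 12 = 1 ∧ t ^ 12 = 1 := by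
  have hc {c : ℂ} (h : W = c • W) : c = 1 := by
    have : (c - 1) • W = 0 := by rw [sub_smul, one_smul, ← h, sub_self]
    exact sub_eq_zero.1 ((smul_eq_zero.1 this).resolve_right hW0)
  -- The relations `S² = -1` and `(ST)³ = -1`, with `-1` acting trivially in even weight, give `s² =
  -- 1` and `(ts)³ = 1`.
  have h2 : s * s = 1 := by
    have h := slash_neg_one W hk
    rw [show (-1 : SL(2, ℤ)) = ModularGroup.S * ModularGroup.S by decide, SlashAction.slash_mul,
      hS, SL_smul_slash, hS, smul_smul] at h
    exact hc h.symm
  have h3 : (t * s) * ((t * s) * (t * s)) = 1 := by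
    have hST : W ∣[k] (ModularGroup.S * ModularGroup.T) = (t * s) • W := by
      rw [SlashAction.slash_mul, hS, SL_smul_slash, hT, smul_smul, mul_comm]
    have h := slash_neg_one W hk
    rw [show (-1 : SL(2, ℤ)) = (ModularGroup.S * ModularGroup.T) *
      ((ModularGroup.S * ModularGroup.T) * (ModularGroup.S * ModularGroup.T)) by decide,
      SlashAction.slash_mul, SlashAction.slash_mul, hST, SL_smul_slash, SL_smul_slash, hST,
      SL_smul_slash, hST, smul_smul, smul_smul] at h
    rw [← mul_assoc]
    exact hc h.symm
  have hs : s ^ 12 = 1 := by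
    rw [show s ^ 12 = (s * s) ^ 6 by ring, h2, one_pow]
  refine ⟨hs, ?_⟩
  have : t ^ 12 * s ^ 12 = 1 := by
    rw [show t ^ 12 * s ^ 12 = ((t * s) * ((t * s) * (t * s))) ^ 4 by ring, h3, one_pow]
  rwa [hs, mul_one] at this

lemma ordAt_pow_mul_discriminant {W : ℍ → ℂ} (hW : MDiff W) (a n : ℕ) (τ : ℍ) :
    ordAt (W ^ a * Δ ^ n) τ = a * ordAt W τ := by
  have aW := analyticAt_ofComplex hW τ
  have aD := analyticAt_ofComplex mdiff_discriminant τ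
  have e : (W ^ a * Δ ^ n) ∘ ofComplex = (W ∘ ofComplex) ^ a * (Δ ∘ ofComplex) ^ n := rfl
  rw [ordAt, ordAt, analyticOrderNatAt, analyticOrderNatAt, e,
    analyticOrderAt_mul (aW.pow a) (aD.pow n), analyticOrderAt_pow aW, analyticOrderAt_pow aD,
    analyticOrderAt_eq_zero_of_ne_zero mdiff_discriminant (discriminant_ne_zero τ)]
  simp

lemma zeroCount_pow_mul_discriminant {W : ℍ → ℂ} (hW : MDiff W) (a n : ℕ) :
    zeroCount (W ^ a * Δ ^ n) = a * zeroCount W := by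
  simp only [zeroCount, ordAt_pow_mul_discriminant hW]
  push_cast
  simp only [← smul_eq_mul (a := (a : ℝ)), smul_add, smul_finsum]
  simp only [smul_eq_mul]
  ring

lemma zeroCount_nonneg (f : ℍ → ℂ) : 0 ≤ zeroCount f := by
  have : 0 ≤ ∑ᶠ x ∈ ({orbitOf UpperHalfPlane.I, orbitOf rhoPoint}ᶜ :
      Set (MulAction.orbitRel.Quotient SL(2, ℤ) ℍ)), (ordAt f x.out : ℝ) :=
    finsum_nonneg fun _ => finsum_nonneg fun _ => Nat.cast_nonneg _
  rw [zeroCount]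
  positivity

/-- The valence inequality: a form `W` of even weight `k` with a character has an order `x` at the
cusp, and `x` plus the number of zeros of `W` is at most `k / 12`. -/
theorem exists_order_add_zeroCount_le {k : ℕ} (hk : Even k) {W : ℍ → ℂ} (hW : MDiff W)
    (hW0 : W ≠ 0) {s t : ℂ} (hS : W ∣[(k : ℤ)] ModularGroup.S = s • W)
    (hT : W ∣[(k : ℤ)] ModularGroup.T = t • W) {m : ℝ} (hm : W =O[atImInfty] qAbs m) :
    ∃ x : ℝ, qAbs x =O[atImInfty] W ∧ x + zeroCount W ≤ k / 12 := by
  obtain ⟨hs, ht⟩ := multiplier_pow_twelve hW0 (by exact_mod_cast hk) hS hT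
  -- `W^12` is `O(|q|^{12m})`, so this `n` makes `W^12 Δ^n` bounded at the cusp.
  obtain ⟨n, hn⟩ := exists_nat_ge (-(12 * m))
  have hinv : ∀ γ : SL(2, ℤ), (W ^ 12) ∣[((12 : ℕ) * k : ℤ)] γ = W ^ 12 := by
    refine SlashInvariantForm.slash_action_generators_SL2Z ?_ ?_
    · rw [pow_slash, hS, smul_pow, hs, one_smul]
    · rw [pow_slash, hT, smul_pow, ht, one_smul]
  have hDinv : ∀ γ : SL(2, ℤ), (Δ ^ n) ∣[(n * 12 : ℤ)] γ = Δ ^ n := fun γ => by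
    rw [pow_slash, discriminant_slash]
  set f : ℍ → ℂ := W ^ 12 * Δ ^ n with hf
  have hW12 : (W ^ 12 : ℍ → ℂ) =O[atImInfty] qAbs (12 * m) := by
    have := hm.pow 12
    rw [show (12 * m : ℝ) = (12 : ℕ) * m by norm_num, qAbs_natMul]
    exact this
  have hDn : (Δ ^ n : ℍ → ℂ) =O[atImInfty] qAbs n := by
    have := discriminant_isBigO.pow n
    rw [← mul_one (n : ℝ), qAbs_natMul]
    exact this
  have hfL : IsLevelOne (12 * (k + n : ℕ)) f := by
    refine ⟨(hW.pow 12).mul (mdiff_discriminant.pow n), fun γ => ?_, ?_⟩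
    · rw [show (12 * (k + n : ℕ) : ℤ) = (12 : ℕ) * k + n * 12 by push_cast; ring, hf,
        mul_slash_SL2, hinv, hDinv]
    · have h1 := hW12.mul hDn
      rw [← qAbs_add] at h1
      have h2 := h1.trans (qAbs_isBigO_of_le (m := 0) (by linarith))
      rw [qAbs_zero] at h2
      exact h2
  obtain ⟨P, hPd, hPf⟩ := exists_polynomial (k + n) hfL
  have hP : P ≠ 0 := by
    rintro rfl
    refine hW0 (funext fun τ => ?_)
    have := hPf τ
    simpa [hf, discriminant_ne_zero] using this
  have h1 := qAbs_isBigO_of_polynomial hP hPd hPf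
  have h2 := zeroCount_le_natDegree hP hPf
  rw [hf, zeroCount_pow_mul_discriminant hW] at h2
  -- `W^12 Δ^n` dominates `|q|^{k+n-deg P}` and has at most `deg P` zeros. Discarding `Δ^n` and
  -- dividing by `12` makes `deg P` cancel from the sum.
  refine ⟨(k - P.natDegree) / 12, ?_, ?_⟩
  · have h3 : qAbs ((k + n : ℕ) - P.natDegree) =O[atImInfty] fun τ => ‖W τ ^ 12‖ * qAbs n τ :=
      h1.trans ((isBigO_refl (fun τ => W τ ^ 12) _).norm_right.mul hDn)
    have h4 := h3.mul (isBigO_refl (qAbs (-n)) atImInfty)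
    rw [← qAbs_add] at h4
    have h5 : (fun τ => qAbs ((k - P.natDegree) / 12) τ ^ 12) =O[atImInfty] fun τ => W τ ^ 12 := by
      rw [← qAbs_natMul]
      refine IsBigO.of_norm_right (h4.congr (fun τ => ?_) fun τ => ?_)
      · congr 1
        push_cast
        ring
      · have := congrFun (qAbs_add n (-n)) τ
        rw [add_neg_cancel, qAbs_zero] at this
        rw [mul_assoc, ← this, mul_one]
    exact h5.of_pow (by norm_num)
  · push_cast at h2
    linarith

end Valence

/-! ### Nonvanishing of the Wronskian -/

section WronskianIndependence

open scoped Matrix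

lemma mdiff_sum_smul {ι : Type*} (s : Finset ι) (c : ι → ℂ) {f : ι → ℍ → ℂ}
    (hf : ∀ i, MDiff (f i)) : MDiff (∑ i ∈ s, c i • f i) := by
  classical
  induction s using Finset.induction_on with
  | empty => exact mdifferentiable_const (c := (0 : ℂ))
  | insert a s ha ih =>
    rw [Finset.sum_insert ha]
    exact ((mdifferentiable_const (c := c a)).mul (hf a)).add ih

/-- If the Wronskian of `n + 1` functions vanishes while the one of the first `n` does not, the last
function is a constant linear combination of the others. -/
lemma exists_const_of_det_eq_zero {n : ℕ} {U : Set ℂ} (hU : IsOpen U) (hUc : IsPreconnected U)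
    {κ : ℂ} {g : ℕ → Fin (n + 1) → ℂ → ℂ}
    (hg : ∀ a i, ∀ z ∈ U, HasDerivAt (g a i) (κ * g (a + 1) i z) z)
    (h1 : ∀ z ∈ U, (Matrix.of fun a i : Fin n => g a i.castSucc z).det ≠ 0)
    (h0 : ∀ z ∈ U, (Matrix.of fun a i : Fin (n + 1) => g a i z).det = 0) :
    ∃ c : Fin n → ℂ, ∀ z ∈ U, g 0 (Fin.last n) z = ∑ i, c i * g 0 i.castSucc z := by
  set M : ℂ → Matrix (Fin n) (Fin n) ℂ := fun z => Matrix.of fun a i => g a i.castSucc z with hM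
  set b : ℂ → Fin n → ℂ := fun z a => g a (Fin.last n) z with hb
  -- Cramer's rule solves the first `n` rows with coefficients that are visibly holomorphic.
  set c : Fin n → ℂ → ℂ := fun i z => (M z).cramer (b z) i / (M z).det with hc
  have hdet : ∀ (A : ℂ → Matrix (Fin n) (Fin n) ℂ),
      (∀ a i, DifferentiableOn ℂ (fun z => A z a i) U) →
      DifferentiableOn ℂ (fun z => (A z).det) U := fun A hA => by
    simp only [Matrix.det_apply]
    exact DifferentiableOn.fun_sum fun σ _ =>
      (DifferentiableOn.fun_finsetProd fun i _ => hA _ _).const_smul _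
  have hgd : ∀ a i, DifferentiableOn ℂ (g a i) U := fun a i z hz =>
    (hg a i z hz).differentiableAt.differentiableWithinAt
  have hcd : ∀ i, DifferentiableOn ℂ (c i) U := fun i => by
    refine DifferentiableOn.div ?_ (hdet M fun a i => hgd a _) h1
    simp only [Matrix.cramer_apply]
    refine hdet _ fun a j => ?_
    by_cases hj : j = i
    · subst hj
      simpa [Matrix.updateCol_self] using hgd a _
    · simpa [Matrix.updateCol_ne hj] using! hgd a _
  have hsolve : ∀ z ∈ U, ∀ a : Fin (n + 1),
      g a (Fin.last n) z = ∑ i, c i z * g a i.castSucc z := fun z hz => by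
    have hMc : M z *ᵥ (fun i => c i z) = b z := by
      have h2 := Matrix.mulVec_cramer (M z) (b z)
      have h3 : (fun i => c i z) = (M z).det⁻¹ • (M z).cramer (b z) := by
        ext i
        simp [hc, div_eq_inv_mul]
      rw [h3, Matrix.mulVec_smul, h2, inv_smul_smul₀ (h1 z hz)]
    -- A kernel vector of the full matrix has nonzero last entry; rescaled, it solves all `n + 1`
    -- rows, and uniqueness on the first `n` identifies it with `c`.
    obtain ⟨u, hu, hMu⟩ := Matrix.exists_mulVec_eq_zero_iff.2 (h0 z hz)
    have hrow : ∀ a : Fin (n + 1),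
        ∑ i : Fin n, g a i.castSucc z * u i.castSucc + g a (Fin.last n) z * u (Fin.last n) = 0 :=
      fun a => by
        have := congrFun hMu a
        simpa [Matrix.mulVec, dotProduct, Fin.sum_univ_castSucc] using this
    have hul : u (Fin.last n) ≠ 0 := fun h => by
      refine hu ?_
      have h4 : M z *ᵥ (fun i => u i.castSucc) = 0 := by
        ext a
        have := hrow a.castSucc
        rw [h, mul_zero, add_zero] at this
        simpa [Matrix.mulVec, dotProduct, hM] using this
      have h5 := Matrix.eq_zero_of_mulVec_eq_zero (h1 z hz) h4
      ext i
      refine Fin.lastCases h (fun j => congrFun h5 j) i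
    have hcu : (fun i => c i z) = fun i : Fin n => -(u i.castSucc / u (Fin.last n)) := by
      refine sub_eq_zero.1 (Matrix.eq_zero_of_mulVec_eq_zero (h1 z hz) ?_)
      rw [Matrix.mulVec_sub]
      refine sub_eq_zero.2 (hMc.trans ?_)
      ext a
      have := hrow a.castSucc
      have h6 : (M z *ᵥ fun i : Fin n => -(u i.castSucc / u (Fin.last n))) a
          = -(∑ i : Fin n, g a i.castSucc z * u i.castSucc) / u (Fin.last n) := by
        simp only [Matrix.mulVec, dotProduct, hM, Matrix.of_apply, neg_div, Finset.sum_div,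
          ← Finset.sum_neg_distrib]
        exact Finset.sum_congr rfl fun i _ => by ring
      rw [h6, eq_div_iff hul]
      simp only [Fin.val_castSucc] at this
      linear_combination this
    intro a
    have := hrow a
    have h7 : ∀ i, c i z = -(u i.castSucc / u (Fin.last n)) := fun i => congrFun hcu i
    simp only [h7]
    have h8 : ∑ i : Fin n, -(u i.castSucc / u (Fin.last n)) * g a i.castSucc z
        = -(∑ i : Fin n, g a i.castSucc z * u i.castSucc) / u (Fin.last n) := by
      simp only [neg_div, Finset.sum_div, ← Finset.sum_neg_distrib]
      exact Finset.sum_congr rfl fun i _ => by ring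
    rw [h8, eq_div_iff hul]
    linear_combination this
  -- Differentiating row `a < n` and subtracting `κ` times row `a + 1` leaves `∑ c_i' g_{a,i} = 0`;
  -- the last row is needed for `a = n - 1`.
  have hderiv : ∀ i, ∀ z ∈ U, deriv (c i) z = 0 := by
    intro i z hz
    have h9 : M z *ᵥ (fun i => deriv (c i) z) = 0 := by
      ext a
      have e1 : (fun z => ∑ i, c i z * g a i.castSucc z) =ᶠ[𝓝 z] g a (Fin.last n) := by
        filter_upwards [hU.mem_nhds hz] with y hy
        exact (hsolve y hy a.castSucc).symm
      have e2 : HasDerivAt (fun z => ∑ i, c i z * g a i.castSucc z)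
          (∑ i, (deriv (c i) z * g a i.castSucc z + c i z * (κ * g (a + 1) i.castSucc z))) z :=
        HasDerivAt.fun_sum fun i _ =>
          (((hcd i).differentiableAt (hU.mem_nhds hz)).hasDerivAt).mul (hg a _ z hz)
      have e3 := (e2.congr_of_eventuallyEq e1.symm).unique (hg a (Fin.last n) z hz)
      have e4 := hsolve z hz a.succ
      simp only [Fin.val_succ] at e4
      rw [Finset.sum_add_distrib, e4, Finset.mul_sum] at e3
      have e5 : ∑ i, c i z * (κ * g (a + 1) i.castSucc z)
          = ∑ i, κ * (c i z * g (a + 1) i.castSucc z) :=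
        Finset.sum_congr rfl fun i _ => by ring
      rw [e5, add_eq_right] at e3
      simpa [Matrix.mulVec, dotProduct, hM, mul_comm] using e3
    exact congrFun (Matrix.eq_zero_of_mulVec_eq_zero (h1 z hz) h9) i
  choose k hk using fun i => hU.exists_is_const_of_deriv_eq_zero hUc (hcd i) fun z hz => hderiv i z hz
  refine ⟨k, fun z hz => ?_⟩
  have := hsolve z hz 0
  simp only [Fin.val_zero] at this
  rw [this]
  exact Finset.sum_congr rfl fun i _ => by rw [hk i z hz]

lemma hasDerivAt_iterate {f : ℍ → ℂ} (hf : MDiff f) (a : ℕ) {z : ℂ} (hz : 0 < z.im) :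
    HasDerivAt (𝒟₁^[a] f ∘ ofComplex)
      (2 * Real.pi * Complex.I * (𝒟₁^[a + 1] f ∘ ofComplex) z) z := by
  have h := (differentiableAt_ofComplex (mdiff_iterate_normalizedDeriv hf a) hz).hasDerivAt
  have e : 2 * Real.pi * Complex.I * (𝒟₁^[a + 1] f ∘ ofComplex) z
      = deriv (𝒟₁^[a] f ∘ ofComplex) z := by
    rw [Function.iterate_succ_apply', Function.comp_apply, normalizedDerivOfComplex,
      ofComplex_apply_of_im_pos hz, mul_inv_cancel_left₀ Complex.two_pi_I_ne_zero]
  rwa [e]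

/-- Linearly independent holomorphic functions have a nonzero Wronskian. -/
theorem wronskian_ne_zero {n : ℕ} {f : Fin n → ℍ → ℂ} (hf : ∀ i, MDiff (f i))
    (hli : LinearIndependent ℂ f) : wronskian f ≠ 0 := by
  induction n with
  | zero =>
    intro h
    have := congrFun h UpperHalfPlane.I
    simp [wronskian] at this
  | succ n ih =>
    intro h
    have hli' := hli.comp Fin.castSucc (Fin.castSucc_injective n)
    obtain ⟨τ, hτ⟩ := Function.ne_iff.1 (ih (fun i => hf i.castSucc) hli')
    have hcont : ContinuousAt (wronskian (f ∘ Fin.castSucc) ∘ ofComplex) τ := by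
      have : wronskian (f ∘ Fin.castSucc) ∘ ofComplex = fun z => Matrix.det (Matrix.of
          fun a i : Fin n => (𝒟₁^[(a : ℕ)] (f i.castSucc) ∘ ofComplex) z) := rfl
      rw [this]
      refine (continuous_id.matrix_det.continuousAt).comp
        (continuousAt_pi.2 fun a => continuousAt_pi.2 fun i => ?_)
      exact (hasDerivAt_iterate (hf _) a τ.im_pos).continuousAt
    have hne : ∀ᶠ z in 𝓝 (τ : ℂ), (wronskian (f ∘ Fin.castSucc) ∘ ofComplex) z ≠ 0 :=
      hcont.eventually_ne (by simpa using! hτ)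
    -- The relation is found on a ball where the smaller Wronskian does not vanish, then spread to
    -- `ℍ` by the identity theorem.
    obtain ⟨r, hr, hball⟩ := Metric.eventually_nhds_iff_ball.1
      (hne.and (isOpen_upperHalfPlaneSet.mem_nhds τ.im_pos))
    obtain ⟨c, hc⟩ := exists_const_of_det_eq_zero (n := n) (Metric.isOpen_ball (x := (τ : ℂ)) (ε := r))
      (convex_ball _ _).isPreconnected (g := fun a i => 𝒟₁^[a] (f i) ∘ ofComplex)
      (fun a i z hz => hasDerivAt_iterate (hf i) a (hball z hz).2)
      (fun z hz => (hball z hz).1) (fun z _ => congrFun h (ofComplex z))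
    have heq : f (Fin.last n) = ∑ i : Fin n, c i • f i.castSucc := by
      refine eq_of_eventuallyEq (τ := τ) (hf _) ?_ ?_
      · exact mdiff_sum_smul _ _ fun i => hf i.castSucc
      · filter_upwards [Metric.ball_mem_nhds _ hr] with z hz
        simpa using hc z hz
    refine (linearIndependent_finSucc'.1 hli).2 ?_
    rw [heq]
    exact Submodule.sum_mem _ fun i _ =>
        Submodule.smul_mem _ _ (Submodule.subset_span (Set.mem_range_self i))

end WronskianIndependence

/-! ### Growth and transformation law of the Wronskian -/

section WronskianTransformation

open scoped Matrix

lemma mdiff_det {n : ℕ} {M : ℍ → Matrix (Fin n) (Fin n) ℂ} (hM : ∀ a i, MDiff fun τ => M τ a i) :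
    MDiff fun τ => (M τ).det := by
  simp only [UpperHalfPlane.mdifferentiable_iff, Function.comp_def, Matrix.det_apply] at hM ⊢
  exact DifferentiableOn.fun_sum fun σ _ =>
    (DifferentiableOn.fun_finsetProd fun i _ => hM _ _).const_smul _

lemma mdiff_wronskian {n : ℕ} {f : Fin n → ℍ → ℂ} (hf : ∀ i, MDiff (f i)) :
    MDiff (wronskian f) :=
  mdiff_det fun a i => mdiff_iterate_normalizedDeriv (hf i) a

lemma qAbs_sum {ι : Type*} (s : Finset ι) (m : ι → ℝ) :
    qAbs (∑ i ∈ s, m i) = fun τ => ∏ i ∈ s, qAbs (m i) τ := by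
  ext τ
  simp only [qAbs, ← Real.exp_sum, Finset.mul_sum, Finset.sum_mul, Finset.sum_neg_distrib]

/-- Every term of the Leibniz expansion takes exactly one entry from each column. -/
lemma isBigO_det {n : ℕ} {M : ℍ → Matrix (Fin n) (Fin n) ℂ} {m : Fin n → ℝ}
    (hM : ∀ a i, (fun τ => M τ a i) =O[atImInfty] qAbs (m i)) :
    (fun τ => (M τ).det) =O[atImInfty] qAbs (∑ i, m i) := by
  simp only [Matrix.det_apply, qAbs_sum]
  refine IsBigO.fun_sum fun σ _ => ?_
  have h : (fun τ => ∏ i, M τ (σ i) i) =O[atImInfty] fun τ => ∏ i, qAbs (m i) τ :=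
    IsBigO.finsetProd fun i _ => hM _ _
  simp only [Units.smul_def, zsmul_eq_mul]
  exact h.const_mul_left _

lemma isBigO_wronskian {n : ℕ} {f : Fin n → ℍ → ℂ} (hf : ∀ i, MDiff (f i)) {m : Fin n → ℝ}
    (hm : ∀ i, f i =O[atImInfty] qAbs (m i)) :
    wronskian f =O[atImInfty] qAbs (∑ i, m i) :=
  isBigO_det fun a i => isBigO_iterate_normalizedDeriv (hf i) (hm i) a

lemma mdiff_slash {f : ℍ → ℂ} (hf : MDiff f) (k : ℤ) (γ : SL(2, ℤ)) : MDiff (f ∣[k] γ) :=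
  MDifferentiable.slash hf k (γ : GL (Fin 2) ℝ)

/-- The covariant derivative of a coefficient of the slash of weight `2 b`. -/
noncomputable def slashD (γ : SL(2, ℤ)) (b : ℕ) (p : ℍ → ℂ) (τ : ℍ) : ℂ :=
  𝒟₁ p τ - (2 * b : ℂ) * (2 * Real.pi * Complex.I)⁻¹ * (γ 1 0 / denom γ τ) * p τ

lemma mdiff_slashD (γ : SL(2, ℤ)) (b : ℕ) {p : ℍ → ℂ} (hp : MDiff p) : MDiff (slashD γ b p) := by
  have h := (mdifferentiable_const (c := (2 * b : ℂ) * (2 * Real.pi * Complex.I)⁻¹)).mul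
    ((mdifferentiable_const (c := ((γ 1 0 : ℤ) : ℂ))).mul
      (mdifferentiable_inv_denom (γ : GL (Fin 2) ℝ)))
  exact (normalizedDerivOfComplex_mdifferentiable hp).sub (h.mul hp)

lemma slashD_zero (γ : SL(2, ℤ)) (b : ℕ) : slashD γ b 0 = 0 := by
  have : 𝒟₁ 0 = 0 := Derivative.normalizedDerivOfComplex_const 0
  ext τ
  simp [slashD, this]

/-- The coefficients of the triangular system expressing the derivatives of `f ∘ γ` through those
of `f`. -/
noncomputable def slashCoeff (γ : SL(2, ℤ)) : ℕ → ℕ → ℍ → ℂ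
  | 0, b => if b = 0 then 1 else 0
  | a + 1, b => slashD γ b (slashCoeff γ a b) + if b = 0 then 0 else slashCoeff γ a (b - 1)

lemma mdiff_slashCoeff (γ : SL(2, ℤ)) (a b : ℕ) : MDiff (slashCoeff γ a b) := by
  induction a generalizing b with
  | zero =>
    rw [slashCoeff]
    split_ifs
    · exact mdifferentiable_const (c := (1 : ℂ))
    · exact mdifferentiable_const (c := (0 : ℂ))
  | succ a ih =>
    rw [slashCoeff]
    refine (mdiff_slashD γ b (ih b)).add ?_
    split_ifs
    · exact mdifferentiable_const (c := (0 : ℂ))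
    · exact ih _

lemma slashCoeff_of_lt (γ : SL(2, ℤ)) {a b : ℕ} (h : a < b) : slashCoeff γ a b = 0 := by
  induction a generalizing b with
  | zero => rw [slashCoeff, if_neg (by lia)]
  | succ a ih =>
    have h1 : slashCoeff γ a b = 0 := ih (by lia)
    have h2 : slashCoeff γ a (b - 1) = 0 := ih (by lia)
    rw [slashCoeff, h1, h2, slashD_zero, ite_self, add_zero]

lemma slashCoeff_self (γ : SL(2, ℤ)) (a : ℕ) : slashCoeff γ a a = 1 := by
  induction a with
  | zero => rw [slashCoeff, if_pos rfl]
  | succ a ih =>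
    rw [slashCoeff, slashCoeff_of_lt γ (Nat.lt_succ_self a), slashD_zero, if_neg (by lia),
      Nat.add_sub_cancel, ih, zero_add]

lemma normalizedDeriv_sum {ι : Type*} (s : Finset ι) {f : ι → ℍ → ℂ} (hf : ∀ i, MDiff (f i)) :
    𝒟₁ (∑ i ∈ s, f i) = ∑ i ∈ s, 𝒟₁ (f i) := by
  classical
  induction s using Finset.induction_on with
  | empty => exact Derivative.normalizedDerivOfComplex_const 0
  | insert a s ha ih =>
    have h := mdiff_sum_smul s (fun _ => 1) hf
    simp only [one_smul] at h
    rw [Finset.sum_insert ha, Finset.sum_insert ha,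
      Derivative.normalizedDerivOfComplex_add _ _ (hf a) h, ih]

lemma iterate_normalizedDeriv_sum_smul {ι : Type*} (s : Finset ι) (c : ι → ℂ) {f : ι → ℍ → ℂ}
    (hf : ∀ i, MDiff (f i)) (a : ℕ) :
    𝒟₁^[a] (∑ i ∈ s, c i • f i) = ∑ i ∈ s, c i • 𝒟₁^[a] (f i) := by
  induction a with
  | zero => rfl
  | succ a ih =>
    simp only [Function.iterate_succ_apply', ih]
    rw [normalizedDeriv_sum (f := fun i => c i • 𝒟₁^[a] (f i)) s fun i =>
      (mdifferentiable_const (c := c i)).mul (mdiff_iterate_normalizedDeriv (hf i) a)]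
    exact Finset.sum_congr rfl fun i _ => Derivative.normalizedDerivOfComplex_smul _ _
      (mdiff_iterate_normalizedDeriv (hf i) a)

/-- Differentiating a slash of weight `2b` gives the slash of weight `2b + 2` of the derivative,
minus a multiple of `γ₁₀ / denom γ`; `slashD` absorbs that correction into the coefficient. -/
lemma iterate_normalizedDeriv_slash {f : ℍ → ℂ} (hf : MDiff f) (γ : SL(2, ℤ)) (a : ℕ) :
    𝒟₁^[a] (f ∣[(0 : ℤ)] γ) =
      ∑ b ∈ Finset.range (a + 1), slashCoeff γ a b * (𝒟₁^[b] f ∣[(2 * b : ℤ)] γ) := by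
  induction a with
  | zero =>
    ext τ
    simp [slashCoeff]
  | succ a ih =>
    have hd (b : ℕ) : MDiff (𝒟₁^[b] f ∣[(2 * b : ℤ)] γ) :=
      mdiff_slash (mdiff_iterate_normalizedDeriv hf b) _ _
    rw [Function.iterate_succ_apply', ih,
      normalizedDeriv_sum _ fun b => (mdiff_slashCoeff γ a b).mul (hd b)]
    have e (b : ℕ) : 𝒟₁ (slashCoeff γ a b * (𝒟₁^[b] f ∣[(2 * b : ℤ)] γ)) =
        slashD γ b (slashCoeff γ a b) * (𝒟₁^[b] f ∣[(2 * b : ℤ)] γ)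
        + slashCoeff γ a b * (𝒟₁^[b + 1] f ∣[(2 * (b + 1 : ℕ) : ℤ)] γ) := by
      rw [normalizedDerivOfComplex_mul _ _ (mdiff_slashCoeff γ a b) (hd b),
        Derivative.normalizedDerivOfComplex_SL_slash (mdiff_iterate_normalizedDeriv hf b),
        ← Function.iterate_succ_apply' (f := 𝒟₁),
        show (2 * (b + 1 : ℕ) : ℤ) = 2 * b + 2 by push_cast; ring]
      ext τ
      simp only [slashD, Pi.add_apply, Pi.mul_apply, Pi.sub_apply]
      push_cast
      ring
    have e' (b : ℕ) : slashCoeff γ (a + 1) b * (𝒟₁^[b] f ∣[(2 * b : ℤ)] γ) =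
        slashD γ b (slashCoeff γ a b) * (𝒟₁^[b] f ∣[(2 * b : ℤ)] γ)
        + (if b = 0 then 0 else slashCoeff γ a (b - 1)) * (𝒟₁^[b] f ∣[(2 * b : ℤ)] γ) := by
      rw [slashCoeff, add_mul]
    simp only [e, e', Finset.sum_add_distrib]
    rw [Finset.sum_range_succ _ (a + 1), slashCoeff_of_lt γ (Nat.lt_succ_self a), slashD_zero,
      zero_mul, add_zero, Finset.sum_range_succ' _ (a + 1), if_pos rfl, zero_mul, add_zero]
    rfl

/-- The derivative matrix of the slashed functions is a unitriangular matrix times the derivative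
matrix at `γ τ` with row `b` scaled by `denom^{-2b}`. The weight is `∑ 2b = n(n-1)`. -/
lemma wronskian_slash {n : ℕ} {f : Fin n → ℍ → ℂ} (hf : ∀ i, MDiff (f i)) (γ : SL(2, ℤ)) :
    wronskian (fun i => f i ∣[(0 : ℤ)] γ) = wronskian f ∣[((n * (n - 1) : ℕ) : ℤ)] γ := by
  ext τ
  have e : (Matrix.of fun a i : Fin n => (𝒟₁^[(a : ℕ)] (f i ∣[(0 : ℤ)] γ)) τ)
      = (Matrix.of fun a b : Fin n => slashCoeff γ a b τ) *
        Matrix.of fun b i : Fin n => denom γ τ ^ (-(2 * (b : ℕ) : ℤ)) *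
          (Matrix.of fun b i : Fin n => (𝒟₁^[(b : ℕ)] (f i)) (γ • τ)) b i := by
    ext a i
    rw [Matrix.of_apply, iterate_normalizedDeriv_slash (hf i), Matrix.mul_apply,
      Finset.sum_apply]
    have h1 : ∀ b ∈ Finset.range n, b ∉ Finset.range ((a : ℕ) + 1) →
        (slashCoeff γ a b * (𝒟₁^[b] (f i) ∣[(2 * b : ℤ)] γ)) τ = 0 := fun b _ hb => by
      rw [slashCoeff_of_lt γ (by simpa using hb), zero_mul]
      rfl
    rw [Finset.sum_subset (Finset.range_subset_range.2 a.isLt) h1, Finset.sum_range]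
    refine Finset.sum_congr rfl fun b _ => ?_
    simp only [Pi.mul_apply, SL_slash_apply, Matrix.of_apply]
    ring
  rw [wronskian, e, Matrix.det_mul, Matrix.det_mul_column, Matrix.det_of_isLowerTriangular]
  · have h2 : (∏ b : Fin n, denom γ τ ^ (-(2 * (b : ℕ) : ℤ)))
        = denom γ τ ^ (-((n * (n - 1) : ℕ) : ℤ)) := by
      rw [← Finset.sum_range_id_mul_two, Finset.sum_range, Finset.sum_mul]
      rw [zpow_neg, zpow_natCast, ← Finset.prod_pow_eq_pow_sum, ← Finset.prod_inv_distrib]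
      refine Finset.prod_congr rfl fun b _ => ?_
      rw [zpow_neg, mul_comm]
      norm_cast
    simp only [Matrix.of_apply, slashCoeff_self, Pi.one_apply, Finset.prod_const_one, one_mul]
    rw [h2, SL_slash_apply, mul_comm]
    rfl
  · intro a b hab
    exact congrFun (slashCoeff_of_lt γ hab) τ

lemma wronskian_sum_smul {n : ℕ} {f : Fin n → ℍ → ℂ} (hf : ∀ i, MDiff (f i))
    (A : Matrix (Fin n) (Fin n) ℂ) :
    wronskian (fun i => ∑ j, A i j • f j) = A.det • wronskian f := by
  ext τ
  have e : (Matrix.of fun a i : Fin n => (𝒟₁^[(a : ℕ)] (∑ j, A i j • f j)) τ)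
      = (Matrix.of fun a i : Fin n => (𝒟₁^[(a : ℕ)] (f i)) τ) * Aᵀ := by
    ext a i
    rw [Matrix.of_apply, iterate_normalizedDeriv_sum_smul _ _ hf, Matrix.mul_apply]
    simp [mul_comm]
  rw [wronskian, e, Matrix.det_mul, Matrix.det_transpose, mul_comm]
  rfl

end WronskianTransformation

/-! ### The bound on the sum of the leading exponents -/

section ChiralBound

/-- For `Im τ ≥ 1` each term, divided by `|q|^m`, is largest at height `1`, so absolute convergence
at `τ = i` bounds the whole series. -/
lemma HasLeadingExponent.isBigO {f : ℍ → ℂ} {m : ℝ} (h : HasLeadingExponent f m) :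
    f =O[atImInfty] qAbs m := by
  obtain ⟨b, hb, c, -, hc⟩ := h
  set t : ℕ → ℍ → ℂ := fun n τ =>
    c n * Complex.exp (2 * Real.pi * Complex.I * ((m : ℂ) + (n : ℂ) / (b : ℂ)) * (τ : ℂ)) with ht
  have hnorm : ∀ n τ, ‖t n τ‖ = ‖c n‖ * Real.exp (-(2 * Real.pi * (m + n / b) * τ.im)) := by
    intro n τ
    have h1 : (2 * Real.pi * Complex.I * ((m : ℂ) + (n : ℂ) / (b : ℂ)) * (τ : ℂ)) =
        ((2 * Real.pi * (m + n / b) : ℝ) : ℂ) * (Complex.I * τ) := by push_cast; ring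
    rw [ht, norm_mul, Complex.norm_exp, h1, Complex.re_ofReal_mul, Complex.I_mul_re]
    congr 2
    simp
  have hsum : Summable fun n => ‖t n UpperHalfPlane.I‖ := (hc UpperHalfPlane.I).summable.norm
  refine IsBigO.of_bound (∑' n, Real.exp (2 * Real.pi * m) * ‖t n UpperHalfPlane.I‖) ?_
  rw [Filter.eventually_iff, atImInfty_mem]
  refine ⟨1, fun τ hτ => ?_⟩
  have hb' : (0 : ℝ) < b := by exact_mod_cast hb
  have hle : ∀ n, ‖t n τ‖ ≤ Real.exp (2 * Real.pi * m) * ‖t n UpperHalfPlane.I‖ * qAbs m τ := by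
    intro n
    rw [hnorm, hnorm, qAbs]
    have h2 : (0 : ℝ) ≤ 2 * Real.pi * (n / b) * (τ.im - 1) :=
      mul_nonneg (by positivity) (by linarith)
    calc ‖c n‖ * Real.exp (-(2 * Real.pi * (m + n / b) * τ.im))
        ≤ ‖c n‖ * Real.exp (2 * Real.pi * m + -(2 * Real.pi * (m + n / b) * 1) +
            -(2 * Real.pi * m * τ.im)) := by
          gcongr
          linarith
      _ = _ := by
          rw [Real.exp_add, Real.exp_add, UpperHalfPlane.I_im]
          ring
  have hq := (hsum.mul_left (Real.exp (2 * Real.pi * m))).hasSum.mul_right (qAbs m τ)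
  have := tsum_of_norm_bounded hq hle
  rw [(hc τ).tsum_eq] at this
  rwa [Set.mem_ofPred_eq, Real.norm_of_nonneg (qAbs_pos m τ).le]

lemma slash_zero_apply (f : ℍ → ℂ) (γ : SL(2, ℤ)) (τ : ℍ) :
    (f ∣[(0 : ℤ)] γ) τ = f (γ • τ) := by
  rw [SL_slash_apply]
  simp

lemma even_mul_sub_one (n : ℕ) : Even (n * (n - 1)) := Nat.even_mul_pred_self n

lemma cast_mul_sub_one (n : ℕ) : ((n * (n - 1) : ℕ) : ℝ) = n * (n - 1) := by
  cases n <;> simp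

lemma VVMF.wronskian_slash {d : ℕ} (v : VVMF d) (γ : SL(2, ℤ)) :
    wronskian v.comp ∣[((d * (d - 1) : ℕ) : ℤ)] γ =
      (v.rep γ : Matrix (Fin d) (Fin d) ℂ).det • wronskian v.comp := by
  rw [← ModularGluing.wronskian_slash v.holo, ← wronskian_sum_smul v.holo]
  congr 1
  ext i τ
  rw [slash_zero_apply, v.transform, Finset.sum_apply]
  rfl

lemma VVMF.sum_exponent_le {d : ℕ} (v : VVMF d) (hli : LinearIndependent ℂ v.comp) :
    ∑ i, v.exponent i ≤ d * (d - 1) / 12 - v.wronskianIndex / 6 := by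
  have hW := isBigO_wronskian v.holo fun i => (v.expansion i).isBigO
  obtain ⟨x, hx, hle⟩ := exists_order_add_zeroCount_le (even_mul_sub_one d)
    (mdiff_wronskian v.holo) (wronskian_ne_zero v.holo hli) (v.wronskian_slash _)
    (v.wronskian_slash _) hW
  have := le_of_qAbs_isBigO (hx.trans hW)
  rw [cast_mul_sub_one] at hle
  rw [VVMF.wronskianIndex]
  linarith

/-- Some pair is at most the average over all `d` pairs, which the two bounds on exponent sums
control. -/
lemma exists_exponent_add_le {d : ℕ} (hd : 0 < d) (v w : VVMF d) (hv : LinearIndependent ℂ v.comp)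
    (hw : LinearIndependent ℂ w.comp) (σ : Equiv.Perm (Fin d)) :
    ∃ i, v.exponent i + w.exponent (σ i) ≤
      ((d : ℝ) - 1) / 6 - (v.wronskianIndex + w.wronskianIndex) / (6 * (d : ℝ)) := by
  have hd' : (0 : ℝ) < d := by exact_mod_cast hd
  have : Nonempty (Fin d) := ⟨⟨0, hd⟩⟩
  by_contra! h
  have h1 := Finset.sum_lt_sum_of_nonempty Finset.univ_nonempty fun i _ => h i
  have h2 : ∑ i, w.exponent (σ i) = ∑ i, w.exponent i := Equiv.sum_comp σ w.exponent
  rw [Finset.sum_add_distrib, h2, Finset.sum_const, Finset.card_univ, Fintype.card_fin,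
    nsmul_eq_mul] at h1
  have h3 : (d : ℝ) * (((d : ℝ) - 1) / 6 - (v.wronskianIndex + w.wronskianIndex) / (6 * (d : ℝ))) =
      d * (d - 1) / 6 - (v.wronskianIndex + w.wronskianIndex) / 6 := by
    field_simp
  linarith [v.sum_exponent_le hv, w.sum_exponent_le hw]

end ChiralBound

/-! ### Polarization of sesquilinear expressions -/

section Polarization

/-- A holomorphic function whose iterated derivatives all vanish at one point is zero. -/
lemma eq_zero_of_iterate_eq_zero {f : ℍ → ℂ} (hf : MDiff f) {τ : ℍ}
    (h : ∀ a, (𝒟₁^[a] f) τ = 0) : f = 0 := by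
  have hD : ∀ a, ∀ᶠ z in 𝓝 (τ : ℂ), iteratedDeriv a (f ∘ ofComplex) z =
      (2 * Real.pi * Complex.I) ^ a * (𝒟₁^[a] f ∘ ofComplex) z := by
    intro a
    induction a with
    | zero => simp
    | succ a ih =>
      filter_upwards [ih.eventually_nhds, isOpen_upperHalfPlaneSet.mem_nhds τ.im_pos] with z hz hz'
      rw [iteratedDeriv_succ, EventuallyEq.deriv_eq hz,
        ((hasDerivAt_iterate hf a hz').const_mul _).deriv]
      ring
  refine eq_of_eventuallyEq hf (mdifferentiable_const (c := (0 : ℂ))) (τ := τ) ?_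
  refine analyticOrderAt_eq_top.1 (ENat.eq_top_iff_forall_ge.2 fun n => ?_)
  refine (natCast_le_analyticOrderAt_iff_iteratedDeriv_eq_zero (analyticAt_ofComplex hf τ)).2
    fun i _ => ?_
  rw [(hD i).self_of_nhds, Function.comp_apply, ofComplex_apply, h, mul_zero]

variable {ι κ : Type*} [Fintype ι] [Fintype κ]

/-- The derivatives in the directions `1` and `i` separate the holomorphic part from the
antiholomorphic part. -/
lemma sum_normalizedDeriv_mul_conj_eq_zero {f g : ι → ℍ → ℂ} (hf : ∀ k, MDiff (f k))
    (hg : ∀ k, MDiff (g k)) (h : ∀ τ, ∑ k, f k τ * conj (g k τ) = 0) (τ : ℍ) :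
    ∑ k, 𝒟₁ (f k) τ * conj (g k τ) = 0 := by
  have hd : ∀ {p : ℍ → ℂ}, MDiff p → ∀ v : ℂ, HasDerivAt
      (fun t : ℝ => (p ∘ ofComplex) (τ + t * v)) (deriv (p ∘ ofComplex) τ * v) 0 := by
    intro p hp v
    have h1 : HasDerivAt (fun t : ℝ => (τ : ℂ) + t * v) v 0 := by
      simpa using ((Complex.ofRealCLM.hasDerivAt (x := (0 : ℝ))).mul_const v).const_add (τ : ℂ)
    have h2 : HasDerivAt (p ∘ ofComplex) (deriv (p ∘ ofComplex) τ) ((τ : ℂ) + (0 : ℝ) * v) := by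
      simpa using (differentiableAt_ofComplex hp τ.im_pos).hasDerivAt
    exact h2.comp 0 h1
  have key : ∀ v : ℂ, ∑ k, (deriv (f k ∘ ofComplex) τ * v * conj (g k τ) +
      f k τ * conj (deriv (g k ∘ ofComplex) τ * v)) = 0 := by
    intro v
    have h1 : HasDerivAt (fun t : ℝ => ∑ k, (f k ∘ ofComplex) (τ + t * v) *
        conj ((g k ∘ ofComplex) (τ + t * v)))
        (∑ k, (deriv (f k ∘ ofComplex) τ * v * conj (g k τ) +
          f k τ * conj (deriv (g k ∘ ofComplex) τ * v))) 0 := by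
      refine HasDerivAt.fun_sum fun k _ => ?_
      refine ((hd (hf k) v).fun_mul ((hd (hg k) v).star)).congr_deriv ?_
      simp
    have h2 : (fun t : ℝ => ∑ k, (f k ∘ ofComplex) (τ + t * v) *
        conj ((g k ∘ ofComplex) (τ + t * v))) = fun _ => 0 := funext fun t => h _
    rw [h2] at h1
    exact h1.unique (hasDerivAt_const _ _)
  have k1 := key 1
  have kI := key Complex.I
  simp only [map_mul, Complex.conj_I, mul_one, Finset.sum_add_distrib] at k1 kI
  have e1 : ∑ k, deriv (f k ∘ ofComplex) τ * Complex.I * conj (g k τ) =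
      Complex.I * ∑ k, deriv (f k ∘ ofComplex) τ * conj (g k τ) := by
    rw [Finset.mul_sum]
    exact Finset.sum_congr rfl fun k _ => by ring
  have e2 : ∑ k, f k τ * (conj (deriv (g k ∘ ofComplex) τ) * -Complex.I) =
      -Complex.I * ∑ k, f k τ * conj (deriv (g k ∘ ofComplex) τ) := by
    rw [Finset.mul_sum]
    exact Finset.sum_congr rfl fun k _ => by ring
  rw [e1, e2] at kI
  have h0 : ∑ k, deriv (f k ∘ ofComplex) τ * conj (g k τ) = 0 := by
    have h3 : (2 * Complex.I) * ∑ k, deriv (f k ∘ ofComplex) τ * conj (g k τ) = 0 := by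
      linear_combination kI + Complex.I * k1
    exact (mul_eq_zero.1 h3).resolve_left (mul_ne_zero two_ne_zero Complex.I_ne_zero)
  simp only [normalizedDerivOfComplex, mul_assoc, ← Finset.mul_sum, h0, mul_zero]

/-- With `w` fixed, all derivatives in `z` vanish at `z = w`, so the holomorphic function of `z` is
zero. -/
lemma sum_mul_conj_eq_zero {f g : ι → ℍ → ℂ} (hf : ∀ k, MDiff (f k))
    (hg : ∀ k, MDiff (g k)) (h : ∀ τ, ∑ k, f k τ * conj (g k τ) = 0) (z w : ℍ) :
    ∑ k, f k z * conj (g k w) = 0 := by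
  have hD : ∀ a τ, ∑ k, (𝒟₁^[a] (f k)) τ * conj (g k τ) = 0 := by
    intro a
    induction a with
    | zero => exact h
    | succ a ih =>
      intro τ
      simpa only [Function.iterate_succ_apply'] using sum_normalizedDeriv_mul_conj_eq_zero
        (fun k => mdiff_iterate_normalizedDeriv (hf k) a) hg ih τ
  have h0 : ∑ k, conj (g k w) • f k = 0 :=
    eq_zero_of_iterate_eq_zero (mdiff_sum_smul _ _ hf) (τ := w) fun a => by
      rw [iterate_normalizedDeriv_sum_smul _ _ hf, Finset.sum_apply, ← hD a w]
      exact Finset.sum_congr rfl fun k _ => mul_comm _ _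
  have h1 := congrFun h0 z
  rw [Finset.sum_apply] at h1
  rw [← Pi.zero_apply (M := fun _ : ℍ => ℂ) z, ← h1]
  exact Finset.sum_congr rfl fun k _ => mul_comm _ _

/-- Two sesquilinear expressions in holomorphic functions which agree on the diagonal have the same
mixed derivatives everywhere. -/
lemma polarization {f g : ι → ℍ → ℂ} {p q : κ → ℍ → ℂ} (hf : ∀ k, MDiff (f k))
    (hg : ∀ k, MDiff (g k)) (hp : ∀ k, MDiff (p k)) (hq : ∀ k, MDiff (q k))
    (h : ∀ τ, ∑ k, f k τ * conj (g k τ) = ∑ l, p l τ * conj (q l τ)) (a b : ℕ) (z w : ℍ) :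
    ∑ k, (𝒟₁^[a] (f k)) z * conj ((𝒟₁^[b] (g k)) w) =
      ∑ l, (𝒟₁^[a] (p l)) z * conj ((𝒟₁^[b] (q l)) w) := by
  have h0 : ∀ z w, ∑ k, f k z * conj (g k w) = ∑ l, p l z * conj (q l w) := by
    intro z w
    have := sum_mul_conj_eq_zero (f := Sum.elim f p) (g := Sum.elim g fun l => (-1 : ℂ) • q l)
      (Sum.rec hf hp) (Sum.rec hg fun l => (mdifferentiable_const (c := (-1 : ℂ))).mul (hq l))
      (fun τ => by simp [Fintype.sum_sum_type, h]) z w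
    simp only [Fintype.sum_sum_type, Sum.elim_inl, Sum.elim_inr, Pi.smul_apply, smul_eq_mul,
      neg_mul, one_mul, map_neg, mul_neg, Finset.sum_neg_distrib] at this
    linear_combination this
  have h1 : ∀ z w, ∑ k, (𝒟₁^[a] (f k)) z * conj (g k w) =
      ∑ l, (𝒟₁^[a] (p l)) z * conj (q l w) := by
    intro z w
    have e : ∑ k, conj (g k w) • f k = ∑ l, conj (q l w) • p l := by
      ext z
      simpa [Finset.sum_apply, mul_comm] using h0 z w
    have e' := congrFun (congrArg (𝒟₁^[a]) e) z
    rw [iterate_normalizedDeriv_sum_smul _ _ hf, iterate_normalizedDeriv_sum_smul _ _ hp] at e'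
    simpa [Finset.sum_apply, mul_comm] using e'
  have e : ∑ k, conj ((𝒟₁^[a] (f k)) z) • g k = ∑ l, conj ((𝒟₁^[a] (p l)) z) • q l := by
    ext w
    simpa [Finset.sum_apply] using congrArg conj (h1 z w)
  have e' := congrArg conj (congrFun (congrArg (𝒟₁^[b]) e) w)
  rw [iterate_normalizedDeriv_sum_smul _ _ hg, iterate_normalizedDeriv_sum_smul _ _ hq] at e'
  simpa [Finset.sum_apply] using e'

/-- The product of determinants is the determinant of the matrix of mixed derivatives, which any
other decomposition of the same function computes as well. This serves both for invariance under `γ`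
and for growth at the cusp. -/
lemma wronskian_mul_conj {n : ℕ} {f g : Fin n → ℍ → ℂ} {p q : κ → ℍ → ℂ} (hf : ∀ k, MDiff (f k))
    (hg : ∀ k, MDiff (g k)) (hp : ∀ k, MDiff (p k)) (hq : ∀ k, MDiff (q k))
    (h : ∀ τ, ∑ k, f k τ * conj (g k τ) = ∑ l, p l τ * conj (q l τ)) (z w : ℍ) :
    wronskian f z * conj (wronskian g w) = Matrix.det (Matrix.of fun a b : Fin n =>
      ∑ l, (𝒟₁^[(a : ℕ)] (p l)) z * conj ((𝒟₁^[(b : ℕ)] (q l)) w)) := by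
  rw [wronskian, wronskian, RingHom.map_det, ← Matrix.det_transpose (RingHom.mapMatrix _ _),
    ← Matrix.det_mul]
  congr 1
  ext a b
  rw [Matrix.of_apply, ← polarization hf hg hp hq h, Matrix.mul_apply]
  rfl

lemma exists_smul_of_mul_conj_eq {A B A' B' : ℍ → ℂ} (hA : A ≠ 0) (hB : B ≠ 0)
    (h : ∀ z w, A' z * conj (B' w) = A z * conj (B w)) : ∃ c : ℂ, A' = c • A := by
  obtain ⟨z, hz⟩ := Function.ne_iff.1 hA
  obtain ⟨w, hw⟩ := Function.ne_iff.1 hB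
  have hw' : conj (B' w) ≠ 0 := fun h0 => by
    have := h z w
    rw [h0, mul_zero] at this
    exact mul_ne_zero hz ((map_ne_zero conj).2 hw) this.symm
  refine ⟨conj (B w) / conj (B' w), funext fun z => ?_⟩
  rw [Pi.smul_apply, smul_eq_mul, div_mul_eq_mul_div, eq_div_iff hw', h]
  ring

end Polarization

/-! ### Minimal decompositions of `F` and the general bound -/

section Gluing

lemma exists_isBigO_of_mem_span {d : ℕ} (v : VVMF d) {f : ℍ → ℂ}
    (hf : f ∈ Submodule.span ℂ (Set.range v.comp)) :
    MDiff f ∧ ∃ m : ℝ, f =O[atImInfty] qAbs m := by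
  induction hf using Submodule.span_induction with
  | mem f hf =>
    obtain ⟨i, rfl⟩ := hf
    exact ⟨v.holo i, _, (v.expansion i).isBigO⟩
  | zero => exact ⟨mdifferentiable_const (c := (0 : ℂ)), 0, isBigO_zero _ _⟩
  | add f g _ _ hf hg =>
    obtain ⟨hf, m, hm⟩ := hf
    obtain ⟨hg, n, hn⟩ := hg
    exact ⟨hf.add hg, min m n, (hm.trans (qAbs_isBigO_of_le (min_le_left _ _))).add
      (hn.trans (qAbs_isBigO_of_le (min_le_right _ _)))⟩
  | smul c f _ hf =>
    obtain ⟨hf, m, hm⟩ := hf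
    exact ⟨(mdifferentiable_const (c := c)).mul hf, m, hm.const_smul_left c⟩

lemma sum_mul_eq_of_sum_smul_eq_zero {n : ℕ} (A B : Fin (n + 1) → ℍ → ℂ) {c : Fin (n + 1) → ℂ}
    (h : ∑ k, c k • A k = 0) {i : Fin (n + 1)} (hi : c i ≠ 0) (τ : ℍ) :
    ∑ k, A k τ * B k τ = ∑ j : Fin n, A (i.succAbove j) τ *
      (B (i.succAbove j) τ - c (i.succAbove j) / c i * B i τ) := by
  have h1 := congrFun h τ
  rw [Fin.sum_univ_succAbove _ i] at h1
  simp only [Pi.add_apply, Finset.sum_apply, Pi.smul_apply, smul_eq_mul, Pi.zero_apply] at h1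
  have h2 : A i τ = -(∑ j : Fin n, c (i.succAbove j) * A (i.succAbove j) τ) / c i := by
    rw [eq_div_iff hi]
    linear_combination h1
  rw [Fin.sum_univ_succAbove _ i, h2]
  simp only [mul_sub, Finset.sum_sub_distrib]
  have h3 : ∑ j : Fin n, A (i.succAbove j) τ * (c (i.succAbove j) / c i * B i τ) =
      (∑ j : Fin n, c (i.succAbove j) * A (i.succAbove j) τ) * (B i τ / c i) := by
    rw [Finset.sum_mul]
    exact Finset.sum_congr rfl fun j _ => by ring
  rw [h3]
  ring

/-- `F` is a sum of `r` products of a function of `V` and the conjugate of a function of `V'`. -/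
def HasSesquilinearRank (V V' : Submodule ℂ (ℍ → ℂ)) (F : ℍ → ℂ) (r : ℕ) : Prop :=
  ∃ f g : Fin r → ℍ → ℂ, (∀ k, f k ∈ V) ∧ (∀ k, g k ∈ V') ∧
    ∀ τ, F τ = ∑ k, f k τ * conj (g k τ)

/-- A linear relation on either side eliminates one term, its coefficients being moved, conjugated,
to the other side. -/
lemma linearIndependent_of_minimal_rank {V V' : Submodule ℂ (ℍ → ℂ)} {F : ℍ → ℂ} {r : ℕ}
    (hr : ∀ s < r, ¬ HasSesquilinearRank V V' F s) {f g : Fin r → ℍ → ℂ} (hf : ∀ k, f k ∈ V)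
    (hg : ∀ k, g k ∈ V') (hF : ∀ τ, F τ = ∑ k, f k τ * conj (g k τ)) :
    LinearIndependent ℂ f ∧ LinearIndependent ℂ g := by
  constructor <;> by_contra hli <;> obtain ⟨c, hc, i, hi⟩ := Fintype.not_linearIndependent_iff.1 hli
  · obtain _ | n := r
    · exact i.elim0
    refine hr n n.lt_succ_self ⟨fun j => f (i.succAbove j),
      fun j => g (i.succAbove j) - conj (c (i.succAbove j) / c i) • g i, fun j => hf _,
      fun j => sub_mem (hg _) (Submodule.smul_mem _ _ (hg _)), fun τ => ?_⟩
    rw [hF, sum_mul_eq_of_sum_smul_eq_zero f (fun k τ => conj (g k τ)) hc hi]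
    simp
  · obtain _ | n := r
    · exact i.elim0
    refine hr n n.lt_succ_self ⟨fun j => f (i.succAbove j) - conj (c (i.succAbove j) / c i) • f i,
      fun j => g (i.succAbove j), fun j => sub_mem (hf _) (Submodule.smul_mem _ _ (hf _)),
      fun j => hg _, fun τ => ?_⟩
    have hc' : ∑ k, conj (c k) • (fun τ => conj (g k τ)) = 0 := by
      ext τ
      simpa [Finset.sum_apply] using congrArg conj (congrFun hc τ)
    have := sum_mul_eq_of_sum_smul_eq_zero (fun k τ => conj (g k τ)) f hc'
      ((map_ne_zero conj).2 hi) τ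
    rw [hF]
    simp only [mul_comm (f _ τ), this]
    exact Finset.sum_congr rfl fun j _ => by simp [mul_comm]

lemma exists_order_of_wronskian {d r : ℕ} (v : VVMF d) {f : Fin r → ℍ → ℂ}
    (hf : ∀ k, f k ∈ Submodule.span ℂ (Set.range v.comp)) (hli : LinearIndependent ℂ f)
    (h : ∀ γ : SL(2, ℤ), ∃ c : ℂ, wronskian f ∣[((r * (r - 1) : ℕ) : ℤ)] γ = c • wronskian f) :
    ∃ x : ℝ, qAbs x =O[atImInfty] wronskian f ∧ x ≤ r * (r - 1) / 12 := by
  have hfd := fun k => (exists_isBigO_of_mem_span v (hf k)).1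
  choose m hm using fun k => (exists_isBigO_of_mem_span v (hf k)).2
  obtain ⟨s, hs⟩ := h ModularGroup.S
  obtain ⟨t, ht⟩ := h ModularGroup.T
  obtain ⟨x, hx, hle⟩ := exists_order_add_zeroCount_le (even_mul_sub_one r) (mdiff_wronskian hfd)
    (wronskian_ne_zero hfd hli) hs ht (isBigO_wronskian hfd hm)
  rw [cast_mul_sub_one] at hle
  exact ⟨x, hx, by linarith [zeroCount_nonneg (wronskian f)]⟩

lemma hasSesquilinearRank_glue {d : ℕ} (N : Matrix (Fin d) (Fin d) ℂ) (v w : VVMF d) :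
    HasSesquilinearRank (Submodule.span ℂ (Set.range v.comp)) (Submodule.span ℂ (Set.range w.comp))
      (glue N v w) d := by
  refine ⟨v.comp, fun i => ∑ j, conj (N i j) • w.comp j,
    fun k => Submodule.subset_span (Set.mem_range_self k), fun k => Submodule.sum_mem _ fun j _ =>
      Submodule.smul_mem _ _ (Submodule.subset_span (Set.mem_range_self j)), fun τ => ?_⟩
  simp only [glue, Finset.sum_apply, Pi.smul_apply, smul_eq_mul, map_sum, map_mul,
    Complex.conj_conj, Finset.mul_sum]
  exact Finset.sum_congr rfl fun i _ => Finset.sum_congr rfl fun j _ => by ring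

/-- Expanding the mixed derivatives through `N` makes every entry `O(|q|^{x₀})`, as only pairs with
`N i j ≠ 0` contribute. The exponents of `f` and `g` taken separately would not show this. -/
lemma isBigO_wronskian_mul_wronskian {d r : ℕ} {N : Matrix (Fin d) (Fin d) ℂ} {v w : VVMF d}
    {f g : Fin r → ℍ → ℂ} (hf : ∀ k, MDiff (f k)) (hg : ∀ k, MDiff (g k))
    (hF : ∀ τ, glue N v w τ = ∑ k, f k τ * conj (g k τ)) {x₀ : ℝ}
    (hx₀ : ∀ i j, N i j ≠ 0 → x₀ ≤ v.exponent i + w.exponent j) :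
    (fun τ => wronskian f τ * wronskian g τ) =O[atImInfty] qAbs (r * x₀) := by
  have h := wronskian_mul_conj (κ := Fin d × Fin d) (p := fun l => N l.1 l.2 • v.comp l.1)
    (q := fun l => w.comp l.2) hf hg
    (fun l => (mdifferentiable_const (c := N l.1 l.2)).mul (v.holo l.1)) (fun l => w.holo l.2)
    fun τ => by rw [← hF, glue, Fintype.sum_prod_type]; rfl
  have h1 : (fun τ => wronskian f τ * conj (wronskian g τ)) =O[atImInfty] qAbs (r * x₀) := by
    have e : (r * x₀ : ℝ) = ∑ _k : Fin r, x₀ := by simp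
    simp only [h, e]
    refine isBigO_det fun a b => ?_
    simp only [Matrix.of_apply]
    refine IsBigO.fun_sum fun l _ => ?_
    have e2 := iterate_normalizedDeriv_sum_smul {l.1} (fun _ => N l.1 l.2) v.holo (a : ℕ)
    simp only [Finset.sum_singleton] at e2
    simp only [e2, Pi.smul_apply, smul_eq_mul, mul_assoc]
    by_cases hN : N l.1 l.2 = 0
    · simp only [hN, zero_mul]
      exact isBigO_zero _ _
    · refine IsBigO.const_mul_left (IsBigO.trans ?_ (qAbs_isBigO_of_le (hx₀ _ _ hN))) _
      rw [qAbs_add]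
      refine (isBigO_iterate_normalizedDeriv (v.holo _) (v.expansion _).isBigO _).mul
        ((isBigO_of_le _ fun τ => ?_).trans
          (isBigO_iterate_normalizedDeriv (w.holo _) (w.expansion _).isBigO b))
      exact (RCLike.norm_conj _).le
  exact (isBigO_of_le _ fun τ => by simp).trans h1

lemma gluedExponent_le {d : ℕ} {N : Matrix (Fin d) (Fin d) ℂ} {v w : VVMF d}
    (hF : ∀ (γ : SL(2, ℤ)) (τ : ℍ), glue N v w (γ • τ) = glue N v w τ)
    (hF0 : ∃ τ : ℍ, glue N v w τ ≠ 0) {x₀ : ℝ}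
    (hx₀ : ∀ i j, N i j ≠ 0 → x₀ ≤ v.exponent i + w.exponent j) :
    x₀ ≤ ((d : ℝ) - 1) / 6 := by
  classical
  have hex : ∃ r, HasSesquilinearRank (Submodule.span ℂ (Set.range v.comp))
    (Submodule.span ℂ (Set.range w.comp)) (glue N v w) r := ⟨d, hasSesquilinearRank_glue N v w⟩
  obtain ⟨r, ⟨f, g, hf, hg, hfg⟩, hmin⟩ : ∃ r, HasSesquilinearRank _ _ (glue N v w) r ∧
      ∀ s < r, ¬ HasSesquilinearRank _ _ (glue N v w) s :=
    ⟨Nat.find hex, Nat.find_spec hex, fun s => Nat.find_min hex⟩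
  have hrd : r ≤ d := not_lt.1 fun hlt => hmin d hlt (hasSesquilinearRank_glue N v w)
  obtain ⟨hfi, hgi⟩ := linearIndependent_of_minimal_rank hmin hf hg hfg
  have hr0 : 0 < r := by
    obtain ⟨τ, hτ⟩ := hF0
    refine Nat.pos_of_ne_zero fun h0 => hτ ?_
    rw [hfg]
    have : IsEmpty (Fin r) := by rw [h0]; infer_instance
    exact Fintype.sum_empty _
  have hfd := fun k => (exists_isBigO_of_mem_span v (hf k)).1
  have hgd := fun k => (exists_isBigO_of_mem_span w (hg k)).1
  have hfn := wronskian_ne_zero hfd hfi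
  have hgn := wronskian_ne_zero hgd hgi
  have hinv : ∀ (γ : SL(2, ℤ)) (z z' : ℍ),
      (wronskian f ∣[((r * (r - 1) : ℕ) : ℤ)] γ) z *
        conj ((wronskian g ∣[((r * (r - 1) : ℕ) : ℤ)] γ) z') =
      wronskian f z * conj (wronskian g z') := by
    intro γ z z'
    rw [← wronskian_slash hfd, ← wronskian_slash hgd]
    have hfs := fun k => mdiff_slash (hfd k) 0 γ
    have hgs := fun k => mdiff_slash (hgd k) 0 γ
    -- The slashed families decompose `F ∘ γ = F`, so both sides are the same determinant.
    rw [wronskian_mul_conj hfs hgs hfd hgd fun τ => ?_,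
      wronskian_mul_conj hfd hgd hfd hgd fun τ => rfl]
    simp only [slash_zero_apply, ← hfg, hF]
  obtain ⟨x, hx, hxle⟩ := exists_order_of_wronskian v hf hfi fun γ =>
    exists_smul_of_mul_conj_eq hfn hgn (hinv γ)
  obtain ⟨y, hy, hyle⟩ := exists_order_of_wronskian w hg hgi fun γ =>
    exists_smul_of_mul_conj_eq hgn hfn fun z z' => by
      simpa [mul_comm] using congrArg conj (hinv γ z' z)
  have hxy : qAbs (x + y) =O[atImInfty] qAbs (r * x₀) := by
    rw [qAbs_add]
    exact (hx.mul hy).trans (isBigO_wronskian_mul_wronskian hfd hgd hfg hx₀)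
  have h1 := le_of_qAbs_isBigO hxy
  have hr0' : (0 : ℝ) < r := by exact_mod_cast hr0
  have h2 : (r : ℝ) * x₀ ≤ r * ((r - 1) / 6) := by linarith
  have h3 : (r : ℝ) ≤ d := by exact_mod_cast hrd
  linarith [le_of_mul_le_mul_left h2 hr0']

end Gluing

end ModularGluing

theorem mainTheorem6 (d : ℕ) (v w : ModularGluing.VVMF d) (N : Matrix (Fin d) (Fin d) ℂ)
    (hF : ∀ (γ : SL(2, ℤ)) (τ : UpperHalfPlane),
      ModularGluing.glue N v w (γ • τ) = ModularGluing.glue N v w τ)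
    (hF0 : ∃ τ : UpperHalfPlane, ModularGluing.glue N v w τ ≠ 0)
    (x₀ : ℝ) (hx₀ : ModularGluing.IsGluedExponent N v w x₀) :
    (LinearIndependent ℂ v.comp → LinearIndependent ℂ w.comp →
      (∃ i j, v.exponent i + w.exponent j ≤
        ((d : ℝ) - 1) / 6 - (v.wronskianIndex + w.wronskianIndex) / (6 * (d : ℝ))) ∧
      (ModularGluing.GluesInPairs N →
        x₀ ≤ ((d : ℝ) - 1) / 6 - (v.wronskianIndex + w.wronskianIndex) / (6 * (d : ℝ)))) ∧
    x₀ ≤ ((d : ℝ) - 1) / 6 := by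
  have hle : ∀ i j, N i j ≠ 0 → x₀ ≤ v.exponent i + w.exponent j :=
    fun i j h => hx₀.2 ⟨i, j, h, rfl⟩
  refine ⟨fun hv hw => ?_, ModularGluing.gluedExponent_le hF hF0 hle⟩
  obtain ⟨⟨i₀, -⟩, -⟩ := hx₀
  have hd : 0 < d := i₀.pos
  constructor
  -- The identity permutation suffices here, since the minimum ranges over all pairs.
  · obtain ⟨i, hi⟩ := ModularGluing.exists_exponent_add_le hd v w hv hw 1
    exact ⟨i, _, hi⟩
  · rintro ⟨σ, hσ⟩
    obtain ⟨i, hi⟩ := ModularGluing.exists_exponent_add_le hd v w hv hw σ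
    exact (hle i _ (hσ i)).trans hi
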